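/- For graphs $F$ and $G$ let $p(F,G)$ be the induced density of $F$ in $G$, i.e. the number of $|V(F)|$-subsets of $V(G)$ that induce a copy of $F$, divided by $\binom{|V(G)|}{|V(F)|}$. Let $i(F)=\lim_{n\to\infty}\max_G p(F,G)$, the maximum over all graphs $G$ on $n$ vertices, and let $i_k(F)$ be defined in the same way with the maximum over all $K_k$-free graphs $G$ on $n$ vertices. For $x=(x_1,\dots,x_\ell)$ with $x_i\ge 0$ and $\sum_i x_i=1$, partition $[0,1]$ into consecutive intervals of lengths $x_1,\dots,x_\ell$ and let the complete $\ell$-partite graphon $W[x]:[0,1]^2\to\{0,1\}$ take the value $1$ at $(s,t)$ if and only if $s$ and $t$ lie in distinct intervals; its part sizes are the nonzero $x_i$. The induced density of $F$ in $W[x]$ is the probability that $|V(F)|$ independent uniformly random points of $[0,1]$ induce a copy of $F$ in $W[x]$, and $W[x]$ attains $i(F)$ (respectively $i_k(F)$) if this density equals $i(F)$ (respectively $i_k(F)$). **Theorem.** Let $r\ge 2$ and let $F=K_{a_1,\dots,a_r}$ (with all $a_i\ge 1$) be a complete $r$-partite graph that is strongly unbalanced, i.e. $(a_i-a_j)^2>a_i+a_j$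 for all $1\le i<j\le r$. Then: 1. for every $k>r$ there is a complete $\ell$-partite graphon with $\ell<k$ that attains $i_k(F)$, and in every such graphon the part sizes are pairwise distinct; 2. there is a complete $\ell$-partite graphon, for some finite $\ell$, that attains $i(F)$, and in every such graphon the part sizes are pairwise distinct. -/

import Mathlib

open Filter Topology MeasureTheory Set
open scoped unitInterval

namespace Inducibility

noncomputable section

/-! ### Induced densities in finite graphs -/

/-- `P(F, G)`: the number of `|V(F)|`-subsets of `V(G)` that induce a subgraph isomorphic
to `F`. -/
def inducedCount {V W : Type*} [Fintype V] (F : SimpleGraph V) (G : SimpleGraph W) : ℕ :=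
  {S : Finset W | S.card = Fintype.card V ∧ Nonempty (G.induce (S : Set W) ≃g F)}.ncard

/-- `p(F, G) = P(F, G) / (|V(G)| choose |V(F)|)`: the induced density of `F` in `G`. -/
def inducedDensity {V W : Type*} [Fintype V] [Fintype W]
    (F : SimpleGraph V) (G : SimpleGraph W) : ℝ :=
  (inducedCount F G : ℝ) / ((Fintype.card W).choose (Fintype.card V) : ℝ)

/-- `i(F, n)`: the maximum of `p(F, G)` over all graphs `G` with `n` vertices. -/
def maxDensity {V : Type*} [Fintype V] (F : SimpleGraph V) (n : ℕ) : ℝ :=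
  ⨆ G : SimpleGraph (Fin n), inducedDensity F G

/-- `i_k(F, n)`: the maximum of `p(F, G)` over all `K_k`-free graphs `G` with `n` vertices. -/
def maxDensityCliqueFree {V : Type*} [Fintype V] (F : SimpleGraph V) (k n : ℕ) : ℝ :=
  ⨆ G : {G : SimpleGraph (Fin n) // G.CliqueFree k}, inducedDensity F G.1

/-! ### Graphons -/

/-- A (`{0,1}`-valued) graphon: a symmetric measurable function `[0,1]² → {0,1}`. -/
structure Graphon where
  toFun : I → I → Fin 2
  symm : ∀ s t, toFun s t = toFun t s
  measurable : Measurable (Function.uncurry toFun)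

/-- The graph induced in the graphon `W` by a family of points of `[0,1]`. -/
def Graphon.inducedGraph (W : Graphon) {V : Type*} (p : V → I) : SimpleGraph V where
  Adj u v := u ≠ v ∧ W.toFun (p u) (p v) = 1
  symm := ⟨fun u v h => ⟨h.1.symm, by rw [W.symm]; exact h.2⟩⟩
  loopless := ⟨fun _ h => h.1 rfl⟩

/-- The induced density of `F` in the graphon `W`: the probability that `|V(F)|` independent
uniformly random points of `[0,1]` induce a copy of `F`. -/
def Graphon.inducedDensity (W : Graphon) {V : Type*} [Fintype V] (F : SimpleGraph V) : ℝ :=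
  (volume : Measure (V → I)).real {p | Nonempty (W.inducedGraph p ≃g F)}

/-- The `i`-th of the consecutive intervals of lengths `x 0, x 1, …` that partition `[0,1]`
(up to the single point `1`, which has measure zero). -/
def interval {l : ℕ} (x : Fin l → ℝ) (i : Fin l) : Set I :=
  {t | ∑ j ∈ Finset.Iio i, x j ≤ (t : ℝ) ∧ (t : ℝ) < ∑ j ∈ Finset.Iic i, x j}

theorem measurableSet_interval {l : ℕ} (x : Fin l → ℝ) (i : Fin l) :
    MeasurableSet (interval x i) :=
  (measurableSet_le measurable_const measurable_subtype_coe).inter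
    (measurableSet_lt measurable_subtype_coe measurable_const)

open Classical in
/-- The complete `l`-partite graphon `W[x 0, …, x (l - 1)]`, for `x` in the standard simplex:
its value at `(s, t)` is `1` if and only if `s` and `t` lie in distinct intervals. -/
def completePartiteGraphon {l : ℕ} (x : Fin l → ℝ) : Graphon where
  toFun s t := if ∃ i j : Fin l, i ≠ j ∧ s ∈ interval x i ∧ t ∈ interval x j then 1 else 0
  symm s t := by
    congr 1
    apply propext
    constructor <;> rintro ⟨i, j, h, hs, ht⟩ <;> exact ⟨j, i, h.symm, ht, hs⟩
  measurable := by
    have hS : MeasurableSet {q : I × I |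
        ∃ i j : Fin l, i ≠ j ∧ q.1 ∈ interval x i ∧ q.2 ∈ interval x j} := by
      simp only [ofPred_exists]
      refine MeasurableSet.iUnion fun i => MeasurableSet.iUnion fun j => ?_
      refine (MeasurableSet.const _).inter ?_
      exact (measurable_fst (measurableSet_interval x i)).inter
        (measurable_snd (measurableSet_interval x j))
    exact Measurable.ite hS measurable_const measurable_const

/-! ### Attaining the inducibility -/

/-- The graphon `W` attains the inducibility `i(F) = lim_n i(F, n)`: the limit exists and equals
the induced density of `F` in `W`. -/
def AttainsInducibility {V : Type*} [Fintype V] (F : SimpleGraph V) (W : Graphon) : Prop :=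
  Tendsto (fun n => maxDensity F n) atTop (𝓝 (W.inducedDensity F))

/-- The graphon `W` attains `i_k(F) = lim_n i_k(F, n)`, the inducibility of `F` over
`K_k`-free graphs: the limit exists and equals the induced density of `F` in `W`. -/
def AttainsCliqueFreeInducibility {V : Type*} [Fintype V] (F : SimpleGraph V) (k : ℕ)
    (W : Graphon) : Prop :=
  Tendsto (fun n => maxDensityCliqueFree F k n) atTop (𝓝 (W.inducedDensity F))

/-! ### Complete partite graphs -/

/-- The complete `r`-partite graph `K_{a_1, …, a_r}`. -/
abbrev completePartite {r : ℕ} (a : Fin r → ℕ) : SimpleGraph (Σ i, Fin (a i)) :=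
  SimpleGraph.completeMultipartiteGraph fun i => Fin (a i)

/-- `(a_i - a_j)² > a_i + a_j` for all `i < j`. -/
def StronglyUnbalanced {r : ℕ} (a : Fin r → ℕ) : Prop :=
  ∀ i j : Fin r, i < j → ((a i : ℤ) - (a j : ℤ)) ^ 2 > (a i : ℤ) + (a j : ℤ)

/-- The nonzero part sizes are pairwise distinct (zero entries do not count as parts). -/
def DistinctPartSizes {l : ℕ} (x : Fin l → ℝ) : Prop :=
  ∀ i j : Fin l, i ≠ j → x i ≠ 0 → x j ≠ 0 → x i ≠ x j

end

end Inducibility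

namespace Inducibility

/-! Strong imbalance forces the `a i` to be distinct, so the induced density of F in a complete
partite graphon with part sizes y is a positive constant times `partiteSum a y`
(`inducedDensity_completePartiteGraphon`, `homDensity_completePartite`). The theorem becomes an
optimization problem for this polynomial on simplices.

Distinct parts. Replace two equal parts c > 0 by c(1 + τ) and c(1 - τ), and average over exchanging
them. Injections that use only one of the two parts do not lose, by convexity. For those that use
both, with exponents a and b, the relative change of the symmetrized term has leading coefficient (a
- b)² - (a + b) at τ², up to a positive constant. Strong imbalance makes it positive, so equal parts
are never optimal (`exists_partiteSum_lt`).

Existence. Zykov symmetrization moves the vertex weights of any finite graph onto a clique without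
lowering the density of F (`exists_clique_support`), so complete partite weightings suffice. A
K_k-free graph leaves at most k - 1 parts, and compactness gives a maximizer. Without clique
restriction the number of parts must first be bounded. When the sum is not small, there are always
large parts left over, and merging two tiny parts costs less than it gains, by a charging argument
(`partiteSum_le_merge`, `exists_bounded_support`).

Passage to the limit. Finite graphs exceed the weighted optimum at most by a factor tending to 1,
and random samples of the optimal weighting reach it on average (`tendsto_iSup_inducedDensity`). -/

/-- The contribution `∏ i, y (f i) ^ a i` of the injection `f` to `partiteSum`. -/
def partiteWeight {r : ℕ} {ι : Type*} (a : Fin r → ℕ) (y : ι → ℝ) (f : Fin r ↪ ι) : ℝ :=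
  ∏ i, y (f i) ^ a i

/-- The sum of `∏ i, y (f i) ^ a i` over all injections `f` into the index set of parts. -/
noncomputable def partiteSum {r : ℕ} {ι : Type*} [Fintype ι] (a : Fin r → ℕ) (y : ι → ℝ) : ℝ :=
  ∑ f : Fin r ↪ ι, partiteWeight a y f

open Classical in
/-- The weight `y` with the values at `u` and `v` replaced by `s` and `t`. -/
noncomputable def replaceTwo {ι : Type*} (y : ι → ℝ) (u v : ι) (s t : ℝ) : ι → ℝ :=
  fun k => if k = u then s else if k = v then t else y k

/-! ### Varying two parts of a weight -/

section Weights

variable {r : ℕ} {ι : Type*} {a : Fin r → ℕ} {y : ι → ℝ} {u v : ι}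

theorem replaceTwo_left (y : ι → ℝ) (u v : ι) (s t : ℝ) : replaceTwo y u v s t u = s := by
  simp [replaceTwo]

theorem replaceTwo_right (y : ι → ℝ) (huv : u ≠ v) (s t : ℝ) : replaceTwo y u v s t v = t := by
  simp [replaceTwo, huv.symm]

theorem replaceTwo_of_ne (y : ι → ℝ) (s t : ℝ) {k : ι} (hu : k ≠ u) (hv : k ≠ v) :
    replaceTwo y u v s t k = y k := by
  simp [replaceTwo, hu, hv]

theorem replaceTwo_self (y : ι → ℝ) (u v : ι) : replaceTwo y u v (y u) (y v) = y := by
  ext k; unfold replaceTwo; split_ifs <;> simp_all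

theorem replaceTwo_nonneg (hy : ∀ i, 0 ≤ y i) {s t : ℝ} (hs : 0 ≤ s) (ht : 0 ≤ t) (k : ι) :
    0 ≤ replaceTwo y u v s t k := by
  unfold replaceTwo; split_ifs <;> simp_all

theorem sum_replaceTwo [Fintype ι] (y : ι → ℝ) (huv : u ≠ v) {s t : ℝ} (h : s + t = y u + y v) :
    ∑ k, replaceTwo y u v s t k = ∑ k, y k := by
  classical
  have key : ∀ z : ι → ℝ, ∑ k, z k = z u + (z v + ∑ k ∈ (Finset.univ.erase u).erase v, z k) := by
    intro z
    rw [Finset.add_sum_erase _ _ (by simp [huv.symm]), Finset.add_sum_erase _ _ (by simp)]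
  rw [key, key y, replaceTwo_left, replaceTwo_right y huv, ← add_assoc, ← add_assoc, h]
  congr 1
  refine Finset.sum_congr rfl fun k hk => ?_
  simp only [Finset.mem_erase, Finset.mem_univ, and_true] at hk
  exact replaceTwo_of_ne y s t hk.2 hk.1

theorem partiteWeight_nonneg (hy : ∀ i, 0 ≤ y i) (f : Fin r ↪ ι) : 0 ≤ partiteWeight a y f :=
  Finset.prod_nonneg fun _ _ => pow_nonneg (hy _) _

/-- Isolates the dependence on the two varied parts: the first factor comes from the other parts
alone and stays fixed when s and t change. -/
theorem partiteWeight_replaceTwo (y : ι → ℝ) (u v : ι) (s t : ℝ) (f : Fin r ↪ ι) :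
    partiteWeight a (replaceTwo y u v s t) f =
      partiteWeight a (replaceTwo y u v 1 1) f *
        partiteWeight a (replaceTwo (fun _ => 1) u v s t) f := by
  unfold partiteWeight
  rw [← Finset.prod_mul_distrib]
  refine Finset.prod_congr rfl fun i _ => ?_
  rw [← mul_pow]
  congr 1
  unfold replaceTwo
  split_ifs <;> simp

theorem partiteWeight_one_of_none {f : Fin r ↪ ι} (hu : ∀ i, f i ≠ u) (hv : ∀ i, f i ≠ v)
    (s t : ℝ) : partiteWeight a (replaceTwo (fun _ => 1) u v s t) f = 1 :=
  Finset.prod_eq_one fun i _ => by rw [replaceTwo_of_ne _ _ _ (hu i) (hv i), one_pow]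

theorem partiteWeight_one_of_left {f : Fin r ↪ ι} {i : Fin r} (hi : f i = u) (hv : ∀ i, f i ≠ v)
    (s t : ℝ) : partiteWeight a (replaceTwo (fun _ => 1) u v s t) f = s ^ a i := by
  unfold partiteWeight
  rw [Finset.prod_eq_single i]
  · rw [hi, replaceTwo_left]
  · intro j _ hj
    rw [replaceTwo_of_ne _ _ _ (fun h => hj (f.injective (h.trans hi.symm))) (hv j), one_pow]
  · simp

theorem partiteWeight_one_of_right {f : Fin r ↪ ι} {i : Fin r} (hi : f i = v)
    (hu : ∀ i, f i ≠ u) (s t : ℝ) :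
    partiteWeight a (replaceTwo (fun _ => 1) u v s t) f = t ^ a i := by
  unfold partiteWeight
  rw [Finset.prod_eq_single i]
  · rw [hi, replaceTwo_right _ (by rintro rfl; exact hu i hi)]
  · intro j _ hj
    rw [replaceTwo_of_ne _ _ _ (hu j) (fun h => hj (f.injective (h.trans hi.symm))), one_pow]
  · simp

theorem partiteWeight_one_of_both {f : Fin r ↪ ι} (huv : u ≠ v) {i j : Fin r} (hi : f i = u)
    (hj : f j = v) (s t : ℝ) :
    partiteWeight a (replaceTwo (fun _ => 1) u v s t) f = s ^ a i * t ^ a j := by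
  have hij : i ≠ j := by rintro rfl; exact huv (hi.symm.trans hj)
  unfold partiteWeight
  rw [Finset.prod_eq_mul i j hij]
  · rw [hi, hj, replaceTwo_left, replaceTwo_right _ huv]
  · rintro k - ⟨hk, hk'⟩
    rw [replaceTwo_of_ne _ _ _ (fun h => hk (f.injective (h.trans hi.symm)))
      (fun h => hk' (f.injective (h.trans hj.symm))), one_pow]
  · simp
  · simp

theorem partiteSum_comp_equiv {κ : Type*} [Fintype ι] [Fintype κ] (e : κ ≃ ι) :
    partiteSum a (y ∘ e) = partiteSum a y := by
  classical
  unfold partiteSum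
  rw [← Equiv.sum_comp (Equiv.embeddingCongr (Equiv.refl _) e)]
  rfl

theorem replaceTwo_comp_swap [DecidableEq ι] (huv : u ≠ v) (s t : ℝ) :
    replaceTwo y u v s t ∘ Equiv.swap u v = replaceTwo y u v t s := by
  ext k
  simp only [Function.comp, Equiv.swap_apply_def]
  unfold replaceTwo
  split_ifs <;> simp_all

/-- The sum is invariant under exchanging u and v. Averaging over this exchange makes later
comparisons possible for each injection separately, which fails for the single terms s^a t^b. -/
theorem two_mul_partiteSum_replaceTwo [Fintype ι] (huv : u ≠ v) (s t : ℝ) :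
    2 * partiteSum a (replaceTwo y u v s t) =
      ∑ f : Fin r ↪ ι, partiteWeight a (replaceTwo y u v 1 1) f *
        (partiteWeight a (replaceTwo (fun _ => 1) u v s t) f +
          partiteWeight a (replaceTwo (fun _ => 1) u v t s) f) := by
  classical
  have h : partiteSum a (replaceTwo y u v s t) = partiteSum a (replaceTwo y u v t s) := by
    rw [← replaceTwo_comp_swap huv, partiteSum_comp_equiv]
  rw [two_mul]
  nth_rw 2 [h]
  unfold partiteSum
  rw [← Finset.sum_add_distrib]
  refine Finset.sum_congr (by congr!) fun f _ => ?_
  rw [partiteWeight_replaceTwo, partiteWeight_replaceTwo y u v t s, mul_add]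

end Weights

/-! ### Splitting two equal parts -/

theorem two_add_le_pow_add_pow {τ : ℝ} (h0 : 0 ≤ τ) (d : ℕ) :
    2 + d * (d - 1) * τ ^ 2 ≤ (1 + τ) ^ d + (1 - τ) ^ d := by
  -- The induction needs the difference as well: raising the exponent by one adds τ times the
  -- difference to the sum, and τ times the sum to the difference.
  have key : 2 + d * (d - 1) * τ ^ 2 ≤ (1 + τ) ^ d + (1 - τ) ^ d ∧
      2 * d * τ ≤ (1 + τ) ^ d - (1 - τ) ^ d := by
    induction d with
    | zero => norm_num
    | succ d ih =>
      obtain ⟨hA, hB⟩ := ih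
      have hd : (0 : ℝ) ≤ d * (d - 1) * τ ^ 2 := by
        rcases d with _ | d
        · simp
        · push_cast; simp only [add_sub_cancel_right]; positivity
      push_cast
      constructor
      · have := mul_le_mul_of_nonneg_left hB h0
        rw [pow_succ (1 + τ), pow_succ (1 - τ)]
        nlinarith
      · have := mul_le_mul_of_nonneg_left hA h0
        have := mul_nonneg h0 hd
        rw [pow_succ (1 + τ), pow_succ (1 - τ)]
        nlinarith
  exact key.1

/-- With a = b + d the expression is (1 - τ²)^b ((1 + τ)^d + (1 - τ)^d). Bernoulli's inequality and
the preceding bound give τ² the coefficient d(d - 1) - 2b, which is positive exactly when (a - b)² >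
a + b. -/
theorem eventually_two_lt_of_le {a b : ℕ} (hba : b ≤ a)
    (h : ((a : ℤ) - b) ^ 2 > (a : ℤ) + b) :
    ∀ᶠ τ : ℝ in 𝓝[>] 0, 2 < (1 + τ) ^ a * (1 - τ) ^ b + (1 - τ) ^ a * (1 + τ) ^ b := by
  obtain ⟨d, rfl⟩ := Nat.exists_eq_add_of_le hba
  have hR : (2 * b : ℝ) < d * (d - 1) := by
    have : (2 * b : ℤ) < d * (d - 1) := by push_cast at h; nlinarith
    exact_mod_cast this
  set D : ℝ := d * (d - 1) with hD
  have hlim : Tendsto (fun τ : ℝ => D * b * τ ^ 2) (𝓝[>] 0) (𝓝 0) := by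
    have : Tendsto (fun τ : ℝ => D * b * τ ^ 2) (𝓝 0) (𝓝 (D * b * 0 ^ 2)) :=
      (Continuous.tendsto (by fun_prop) 0)
    simpa using this.mono_left nhdsWithin_le_nhds
  have h1 : ∀ᶠ τ : ℝ in 𝓝[>] 0, τ < 1 :=
    (eventually_lt_nhds one_pos).filter_mono nhdsWithin_le_nhds
  filter_upwards [hlim.eventually (eventually_lt_nhds (sub_pos.2 hR)), self_mem_nhdsWithin, h1]
    with τ hτ h0 h1
  have h0 : 0 < τ := h0
  have hτ2 : 0 < τ ^ 2 := by positivity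
  have hτ1 : τ ^ 2 ≤ 1 := by nlinarith
  have hfac : (1 + τ) ^ (b + d) * (1 - τ) ^ b + (1 - τ) ^ (b + d) * (1 + τ) ^ b =
      (1 - τ ^ 2) ^ b * ((1 + τ) ^ d + (1 - τ) ^ d) := by
    have : (1 - τ ^ 2) = (1 + τ) * (1 - τ) := by ring
    rw [this, mul_pow]; ring
  have hbern : 1 - b * τ ^ 2 ≤ (1 - τ ^ 2) ^ b := by
    have := one_add_mul_le_pow (a := -τ ^ 2) (by linarith) b
    calc 1 - b * τ ^ 2 = 1 + b * -τ ^ 2 := by ring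
      _ ≤ (1 + -τ ^ 2) ^ b := this
      _ = _ := by ring
  have hA := two_add_le_pow_add_pow h0.le d
  rw [← hD] at hA
  have hDn : 0 ≤ D := le_trans (by positivity) hR.le
  rw [hfac]
  calc (2 : ℝ) < (1 - b * τ ^ 2) * (2 + D * τ ^ 2) := by nlinarith
    _ ≤ (1 - τ ^ 2) ^ b * (2 + D * τ ^ 2) := by gcongr
    _ ≤ _ := by
      have : 0 ≤ (1 - τ ^ 2) ^ b := pow_nonneg (by linarith) b
      gcongr

theorem eventually_two_lt {a b : ℕ} (h : ((a : ℤ) - b) ^ 2 > (a : ℤ) + b) :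
    ∀ᶠ τ : ℝ in 𝓝[>] 0, 2 < (1 + τ) ^ a * (1 - τ) ^ b + (1 - τ) ^ a * (1 + τ) ^ b := by
  rcases le_total b a with hba | hab
  · exact eventually_two_lt_of_le hba h
  · filter_upwards [eventually_two_lt_of_le hab (by nlinarith)] with τ hτ
    nlinarith

theorem StronglyUnbalanced.of_ne {r : ℕ} {a : Fin r → ℕ} (hF : StronglyUnbalanced a)
    {i j : Fin r} (h : i ≠ j) : ((a i : ℤ) - a j) ^ 2 > (a i : ℤ) + a j := by
  rcases lt_or_gt_of_ne h with h | h
  · exact hF i j h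
  · have := hF j i h; nlinarith

theorem StronglyUnbalanced.injective {r : ℕ} {a : Fin r → ℕ} (hF : StronglyUnbalanced a) :
    Function.Injective a := by
  intro i j h
  by_contra hij
  have := hF.of_ne hij
  rw [h] at this
  simp only [sub_self] at this
  omega

/-- Two transpositions within s, applied after f, bring two of its values to u and v. The second
does not disturb the first. -/
theorem exists_embedding_through {ι : Type*} {r : ℕ} (hr : 2 ≤ r) (s : Set ι) (f : Fin r ↪ ι)
    (hf : ∀ i, f i ∈ s) {u v : ι} (huv : u ≠ v) (hu : u ∈ s) (hv : v ∈ s) :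
    ∃ g : Fin r ↪ ι, (∀ i, g i ∈ s) ∧ ∃ i j, g i = u ∧ g j = v := by
  classical
  have hswap : ∀ {p q x : ι}, p ∈ s → q ∈ s → x ∈ s → Equiv.swap p q x ∈ s := by
    intro p q x hp hq hx
    rw [Equiv.swap_apply_def]
    split_ifs <;> assumption
  let i : Fin r := ⟨0, by omega⟩
  let j : Fin r := ⟨1, by omega⟩
  have hij : i ≠ j := by simp [i, j]
  let g : Fin r ↪ ι := f.trans (Equiv.swap (f i) u).toEmbedding
  have hg : ∀ k, g k ∈ s := fun k => hswap (hf i) hu (hf k)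
  have hgi : g i = u := by simp [g]
  refine ⟨g.trans (Equiv.swap (g j) v).toEmbedding, fun k => hswap (hg j) hv (hg k), i, j, ?_, ?_⟩
  · simp only [Function.Embedding.trans_apply, Equiv.toEmbedding_apply, hgi]
    exact Equiv.swap_apply_of_ne_of_ne (fun h => hij (g.injective (hgi.trans h))) huv
  · simp

/-- Two equal parts can be made unequal so as to increase the sum strictly. -/
theorem exists_partiteSum_lt {r : ℕ} {ι : Type*} [Fintype ι] (hr : 2 ≤ r) {a : Fin r → ℕ}
    (ha : ∀ i, 1 ≤ a i) (hF : StronglyUnbalanced a) {y : ι → ℝ} (hy : ∀ i, 0 ≤ y i)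
    (hpos : 0 < partiteSum a y) {u v : ι} (huv : u ≠ v) (hu : 0 < y u) (he : y u = y v) :
    ∃ s t, 0 ≤ s ∧ 0 ≤ t ∧ s + t = y u + y v ∧
      partiteSum a y < partiteSum a (replaceTwo y u v s t) := by
  classical
  have h1 : ∀ᶠ τ : ℝ in 𝓝[>] 0, τ < 1 :=
    (eventually_lt_nhds one_pos).filter_mono nhdsWithin_le_nhds
  -- There are finitely many pairs, so one τ serves all of them.
  have h2 : ∀ᶠ τ : ℝ in 𝓝[>] 0, ∀ i j, i ≠ j →
      2 < (1 + τ) ^ a i * (1 - τ) ^ a j + (1 - τ) ^ a i * (1 + τ) ^ a j := by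
    refine eventually_all.2 fun i => eventually_all.2 fun j => ?_
    by_cases h : i = j
    · simp [h]
    · simpa [h] using eventually_two_lt (hF.of_ne h)
  obtain ⟨τ, hτ1, hτ, hτ0⟩ := (h1.and (h2.and self_mem_nhdsWithin)).exists
  have hτ0 : 0 < τ := hτ0
  set c := y u with hc
  have hpow : ∀ n : ℕ, 2 * c ^ n ≤ (c * (1 + τ)) ^ n + (c * (1 - τ)) ^ n := by
    intro n
    have h := two_add_le_pow_add_pow hτ0.le n
    have hn : (0 : ℝ) ≤ n * (n - 1) * τ ^ 2 := by
      rcases n with _ | n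
      · simp
      · push_cast; simp only [add_sub_cancel_right]; positivity
    rw [mul_pow, mul_pow, ← mul_add]
    nlinarith [pow_pos hu n]
  have hboth : ∀ i j, i ≠ j → 2 * (c ^ a i * c ^ a j) <
      (c * (1 + τ)) ^ a i * (c * (1 - τ)) ^ a j + (c * (1 - τ)) ^ a i * (c * (1 + τ)) ^ a j := by
    intro i j hij
    have h := hτ i j hij
    have hcc : 0 < c ^ a i * c ^ a j := by positivity
    calc 2 * (c ^ a i * c ^ a j) < c ^ a i * c ^ a j *
          ((1 + τ) ^ a i * (1 - τ) ^ a j + (1 - τ) ^ a i * (1 + τ) ^ a j) := by nlinarith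
      _ = _ := by simp only [mul_pow]; ring
  refine ⟨c * (1 + τ), c * (1 - τ), by positivity, mul_nonneg hu.le (by linarith),
    by rw [← he]; ring, ?_⟩
  have hself : partiteSum a y = partiteSum a (replaceTwo y u v c c) := by
    conv_lhs => rw [← replaceTwo_self y u v, ← he]
  have hC : ∀ f : Fin r ↪ ι, 0 ≤ partiteWeight a (replaceTwo y u v 1 1) f := fun f =>
    partiteWeight_nonneg (replaceTwo_nonneg hy zero_le_one zero_le_one) f
  rw [hself, ← mul_lt_mul_iff_right₀ (two_pos (α := ℝ)), two_mul_partiteSum_replaceTwo huv,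
    two_mul_partiteSum_replaceTwo huv]
  obtain ⟨f₀, hf₀⟩ : ∃ f : Fin r ↪ ι, ∀ i, f i ∈ {k | 0 < y k} := by
    by_contra! hcon
    refine hpos.ne' (Finset.sum_eq_zero fun f _ => ?_)
    obtain ⟨i, hi⟩ := hcon f
    refine Finset.prod_eq_zero (Finset.mem_univ i) ?_
    have : y (f i) = 0 := le_antisymm (not_lt.1 hi) (hy _)
    rw [this, zero_pow (by have := ha i; omega)]
  -- The strict gain comes from this g, which uses both equal parts and otherwise only parts of
  -- positive size.
  obtain ⟨g, hg, i₀, j₀, hgi, hgj⟩ := exists_embedding_through hr {k | 0 < y k} f₀ hf₀ huv hu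
    (he ▸ hu : 0 < y v)
  refine Finset.sum_lt_sum (fun f _ => mul_le_mul_of_nonneg_left ?_ (hC f))
    ⟨g, Finset.mem_univ _, ?_⟩
  · by_cases hfu : ∃ i, f i = u
    · obtain ⟨i, hi⟩ := hfu
      by_cases hfv : ∃ j, f j = v
      · obtain ⟨j, hj⟩ := hfv
        have hij : i ≠ j := by rintro rfl; exact huv (hi.symm.trans hj)
        simp only [partiteWeight_one_of_both huv hi hj]
        linarith [hboth i j hij]
      · push Not at hfv
        simp only [partiteWeight_one_of_left hi hfv]
        linarith [hpow (a i)]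
    · push Not at hfu
      by_cases hfv : ∃ j, f j = v
      · obtain ⟨j, hj⟩ := hfv
        simp only [partiteWeight_one_of_right hj hfu]
        linarith [hpow (a j)]
      · push Not at hfv
        simp only [partiteWeight_one_of_none hfu hfv]
        exact le_rfl
  · have hij : i₀ ≠ j₀ := by rintro rfl; exact huv (hgi.symm.trans hgj)
    refine mul_lt_mul_of_pos_left ?_ ?_
    · simp only [partiteWeight_one_of_both huv hgi hgj]
      linarith [hboth i₀ j₀ hij]
    · refine Finset.prod_pos fun k _ => pow_pos ?_ _
      unfold replaceTwo
      split_ifs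
      · exact one_pos
      · exact one_pos
      · exact hg k

/-! ### Merging small parts -/

/-- Merging loses the left side on injections using both parts and gains the bracket on those using
one part with exponent b. Since b ≥ 2, the bracket is at least s t^(b-1) + t s^(b-1), and each term
on the left carries an extra factor at most δ. -/
theorem pow_mul_pow_add_le {s t δ : ℝ} (hs : 0 ≤ s) (ht : 0 ≤ t) (hsδ : s ≤ δ) (htδ : t ≤ δ)
    (hδ : δ ≤ 1) {b c : ℕ} (hb : 2 ≤ b) (hc : 1 ≤ c) :
    s ^ c * t ^ b + t ^ c * s ^ b ≤ δ * ((s + t) ^ b - s ^ b - t ^ b) := by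
  obtain ⟨b, rfl⟩ : ∃ n, b = n + 1 := ⟨b - 1, by omega⟩
  obtain ⟨c, rfl⟩ : ∃ n, c = n + 1 := ⟨c - 1, by omega⟩
  have hδ0 : 0 ≤ δ := hs.trans hsδ
  have hD : s * t ^ b + t * s ^ b ≤ (s + t) ^ (b + 1) - s ^ (b + 1) - t ^ (b + 1) := by
    have h : s ^ b + t ^ b ≤ (s + t) ^ b := pow_add_pow_le hs ht (by omega)
    have := mul_le_mul_of_nonneg_right h (add_nonneg hs ht)
    rw [pow_succ (s + t), pow_succ s, pow_succ t]
    linarith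
  have aux : ∀ {p q : ℝ}, 0 ≤ p → 0 ≤ q → p ≤ δ → q ≤ δ →
      p ^ (c + 1) * q ^ (b + 1) ≤ δ * (p * q ^ b) := by
    intro p q hp hq hpδ hqδ
    have h1 : p ^ c * q ≤ 1 * δ := by
      refine mul_le_mul (pow_le_one₀ hp (hpδ.trans hδ)) hqδ hq zero_le_one
    have h2 : 0 ≤ p * q ^ b := by positivity
    calc p ^ (c + 1) * q ^ (b + 1) = (p ^ c * q) * (p * q ^ b) := by ring
      _ ≤ (1 * δ) * (p * q ^ b) := mul_le_mul_of_nonneg_right h1 h2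
      _ = _ := by ring
  have := aux hs ht hsδ htδ
  have := aux ht hs htδ hsδ
  have := mul_le_mul_of_nonneg_left hD hδ0
  linarith

theorem partiteWeight_mul_of_agree {r : ℕ} {ι : Type*} {a : Fin r → ℕ} {z : ι → ℝ} {f g : Fin r ↪ ι} {i : Fin r}
    (h : ∀ k, k ≠ i → g k = f k) :
    partiteWeight a z g * z (f i) ^ a i = partiteWeight a z f * z (g i) ^ a i := by
  classical
  unfold partiteWeight
  rw [← Finset.mul_prod_erase _ _ (Finset.mem_univ i),
    ← Finset.mul_prod_erase _ (fun k => z (f k) ^ a k) (Finset.mem_univ i),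
    Finset.prod_congr rfl (g := fun k => z (f k) ^ a k)
      fun k hk => by rw [h k (Finset.ne_of_mem_erase hk)]]
  ring

/-- If each negative term is outweighed by a share of a nonnegative term, and every term is charged
at most `card β` times, then the total is nonnegative. -/
theorem sum_nonneg_of_charge {α β : Type*} [Fintype α] [Fintype β] [DecidableEq α]
    [DecidableEq β] {A : Finset α} {Δ : α → ℝ} {φ : α → α × β} {c δ : ℝ} (hc : 0 < c)
    (hδ0 : 0 ≤ δ) (hδ : δ * Fintype.card β ≤ c) (hinj : Set.InjOn φ (A : Set α))
    (hA : ∀ f ∈ A, (φ f).1 ∉ A) (hnn : ∀ f ∉ A, 0 ≤ Δ f)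
    (h : ∀ f ∈ A, c * -Δ f ≤ δ * Δ (φ f).1) : 0 ≤ ∑ f, Δ f := by
  have hAsum : c * ∑ f ∈ A, -Δ f ≤ c * ∑ g ∈ Aᶜ, Δ g := by
    calc c * ∑ f ∈ A, -Δ f = ∑ f ∈ A, c * -Δ f := Finset.mul_sum _ _ _
      _ ≤ ∑ f ∈ A, δ * Δ (φ f).1 := Finset.sum_le_sum h
      _ = ∑ p ∈ A.image φ, δ * Δ p.1 := (Finset.sum_image (f := fun p => δ * Δ p.1) hinj).symm
      -- Injectivity of φ into pairs is what limits the charges on one term to the number of labels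
      -- in β.
      _ ≤ ∑ p ∈ Aᶜ ×ˢ (Finset.univ : Finset β), δ * Δ p.1 := by
        refine Finset.sum_le_sum_of_subset_of_nonneg ?_ fun p hp _ => ?_
        · intro p hp
          obtain ⟨f, hf, rfl⟩ := Finset.mem_image.1 hp
          simpa using hA f hf
        · exact mul_nonneg hδ0 (hnn _ (by simpa using hp))
      _ = (δ * Fintype.card β) * ∑ g ∈ Aᶜ, Δ g := by
        rw [Finset.sum_product, Finset.mul_sum]
        refine Finset.sum_congr rfl fun g _ => ?_
        simp only [Finset.sum_const, Finset.card_univ, nsmul_eq_mul]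
        ring
      _ ≤ c * ∑ g ∈ Aᶜ, Δ g := mul_le_mul_of_nonneg_right hδ
        (Finset.sum_nonneg fun g hg => hnn g (by simpa using hg))
  have hle := le_of_mul_le_mul_left hAsum hc
  rw [Finset.sum_neg_distrib] at hle
  rw [← Finset.sum_add_sum_compl A]
  linarith

section Merge

variable {r : ℕ} {ι : Type*} [Fintype ι] {a : Fin r → ℕ} {y : ι → ℝ} {u v : ι}

/-- If the sum is not small, no `r - 2` parts leave only small parts. -/
theorem exists_large_part (ha : ∀ i, 1 ≤ a i) (hinj : Function.Injective a)
    (hy : ∀ i, 0 ≤ y i) (hy1 : ∑ i, y i = 1) {μ : ℝ} (hμ : 0 < μ) (hE : μ ≤ partiteSum a y)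
    (T : Finset ι) (hT : T.card + 2 ≤ r) : ∃ l ∉ T, μ / 2 ≤ y l := by
  classical
  by_contra! hcon
  have hle1 : ∀ i, y i ≤ 1 := fun i =>
    hy1 ▸ Finset.single_le_sum (fun j _ => hy j) (Finset.mem_univ i)
  have hterm : ∀ g : Fin r ↪ ι, partiteWeight a y g ≤ μ / 2 * ∏ i, y (g i) := by
    intro g
    -- At least two indices land outside T, and distinct exponents cannot both be 1. A square of a
    -- small part then yields the factor μ / 2.
    obtain ⟨k, hk, hak⟩ : ∃ k, g k ∉ T ∧ 2 ≤ a k := by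
      have h1 : (Finset.univ.filter fun k => g k ∈ T).card ≤ T.card :=
        Finset.card_le_card_of_injOn g (by intro k hk; simpa using hk) g.injective.injOn
      have h2 := Finset.card_filter_add_card_filter_not (s := (Finset.univ : Finset (Fin r)))
        (fun k => g k ∈ T)
      rw [Finset.card_univ, Fintype.card_fin] at h2
      obtain ⟨k, hk, k', hk', hne⟩ := Finset.one_lt_card.1
        (show 1 < (Finset.univ.filter fun k => ¬ g k ∈ T).card by omega)
      simp only [Finset.mem_filter, Finset.mem_univ, true_and] at hk hk'
      have hak := ha k
      have hak' := ha k'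
      have := hinj.ne hne
      by_cases h : 2 ≤ a k
      · exact ⟨k, hk, h⟩
      · exact ⟨k', hk', by omega⟩
    unfold partiteWeight
    rw [← Finset.mul_prod_erase _ _ (Finset.mem_univ k),
      ← Finset.mul_prod_erase _ (fun i => y (g i)) (Finset.mem_univ k), ← mul_assoc]
    refine mul_le_mul ?_ (Finset.prod_le_prod (fun i _ => pow_nonneg (hy _) _) fun i _ => ?_)
      (Finset.prod_nonneg fun i _ => pow_nonneg (hy _) _) (mul_nonneg (by linarith) (hy _))
    · calc y (g k) ^ a k ≤ y (g k) ^ 2 := pow_le_pow_of_le_one (hy _) (hle1 _) hak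
        _ = y (g k) * y (g k) := sq _
        _ ≤ μ / 2 * y (g k) := mul_le_mul_of_nonneg_right (hcon _ hk).le (hy _)
    · exact pow_le_of_le_one (hy _) (hle1 _) (by have := ha i; omega)
  have hsum : ∑ g : Fin r ↪ ι, ∏ i, y (g i) ≤ 1 := by
    have h := Fintype.sum_pow y r
    rw [hy1, one_pow] at h
    rw [h, ← Finset.sum_image (f := fun g : Fin r → ι => ∏ i, y (g i)) (s := Finset.univ)
      (g := fun g : Fin r ↪ ι => (g : Fin r → ι)) (DFunLike.coe_injective.injOn)]
    exact Finset.sum_le_sum_of_subset_of_nonneg (Finset.subset_univ _)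
      fun _ _ _ => Finset.prod_nonneg fun _ _ => hy _
  have : partiteSum a y ≤ μ / 2 * 1 := by
    refine (Finset.sum_le_sum fun g _ => hterm g).trans ?_
    rw [← Finset.mul_sum]
    exact mul_le_mul_of_nonneg_left hsum (by linarith)
  linarith

/-- Merging two small parts does not decrease the sum, provided that there are enough large
parts. -/
theorem partiteSum_le_merge (hr : 0 < r) (ha : ∀ i, 1 ≤ a i) (hinj : Function.Injective a)
    (hy : ∀ i, 0 ≤ y i) (hle1 : ∀ i, y i ≤ 1) {ε δ : ℝ} (hε : 0 < ε)
    (hlarge : ∀ T : Finset ι, T.card + 2 ≤ r → ∃ l ∉ T, ε ≤ y l)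
    (hδ1 : δ ≤ 1) (hδε : δ < ε) (hδ : δ * r ≤ ε ^ ∑ i, a i)
    (huv : u ≠ v) (hu : y u ≤ δ) (hv : y v ≤ δ) :
    partiteSum a y ≤ partiteSum a (replaceTwo y u v (y u + y v) 0) := by
  classical
  set s := y u with hs
  set t := y v with ht
  have hs0 : 0 ≤ s := hy u
  have ht0 : 0 ≤ t := hy v
  have hδ0 : 0 ≤ δ := hs0.trans hu
  have hself : partiteSum a y = partiteSum a (replaceTwo y u v s t) := by
    rw [replaceTwo_self y u v]
  let C : (Fin r ↪ ι) → ℝ := fun f => partiteWeight a (replaceTwo y u v 1 1) f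
  have hC : ∀ f, 0 ≤ C f := fun f =>
    partiteWeight_nonneg (replaceTwo_nonneg hy zero_le_one zero_le_one) f
  let w : ℝ → ℝ → (Fin r ↪ ι) → ℝ := fun p q f =>
    partiteWeight a (replaceTwo (fun _ => 1) u v p q) f
  -- The change caused by merging in the symmetrized term of f. It can be negative only if f uses
  -- both u and v.
  let Δ : (Fin r ↪ ι) → ℝ := fun f =>
    C f * ((w (s + t) 0 f + w 0 (s + t) f) - (w s t f + w t s f))
  have hz : ∀ i, (0 : ℝ) ^ a i = 0 := fun i => zero_pow (by have := ha i; omega)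
  have hΔl : ∀ {f : Fin r ↪ ι} {j}, f j = u → (∀ i, f i ≠ v) →
      Δ f = C f * ((s + t) ^ a j - s ^ a j - t ^ a j) := by
    intro f j hj hfv
    simp only [Δ, w, partiteWeight_one_of_left hj hfv, hz]; ring
  have hΔr : ∀ {f : Fin r ↪ ι} {j}, f j = v → (∀ i, f i ≠ u) →
      Δ f = C f * ((s + t) ^ a j - s ^ a j - t ^ a j) := by
    intro f j hj hfu
    simp only [Δ, w, partiteWeight_one_of_right hj hfu, hz]; ring
  have hΔb : ∀ {f : Fin r ↪ ι} {i j}, f i = u → f j = v →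
      Δ f = - (C f * (s ^ a i * t ^ a j + t ^ a i * s ^ a j)) := by
    intro f i j hi hj
    simp only [Δ, w, partiteWeight_one_of_both huv hi hj, hz]; ring
  have hDnn : ∀ j, 0 ≤ (s + t) ^ a j - s ^ a j - t ^ a j := fun j => by
    linarith [pow_add_pow_le hs0 ht0 (show a j ≠ 0 by have := ha j; omega)]
  let A : Finset (Fin r ↪ ι) := Finset.univ.filter fun f => (∃ i, f i = u) ∧ ∃ j, f j = v
  have hnn : ∀ f ∉ A, 0 ≤ Δ f := by
    intro f hf
    simp only [A, Finset.mem_filter, Finset.mem_univ, true_and, not_and] at hf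
    by_cases hfu : ∃ i, f i = u
    · obtain ⟨i, hi⟩ := hfu
      have := hf ⟨i, hi⟩
      push Not at this
      rw [hΔl hi this]
      exact mul_nonneg (hC f) (hDnn i)
    · push Not at hfu
      by_cases hfv : ∃ j, f j = v
      · obtain ⟨j, hj⟩ := hfv
        rw [hΔr hj hfu]
        exact mul_nonneg (hC f) (hDnn j)
      · push Not at hfv
        simp only [Δ, w, partiteWeight_one_of_none hfu hfv]
        simp
  set v₀ := ∑ i, a i with hv₀
  -- The charging rule: of the two indices sent to u and v, keep one with exponent at least 2 and
  -- move the other to an unused large part. The moved index is recorded as the label, so a term is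
  -- charged at most r times.
  have hcharge : ∀ f, ∃ p : (Fin r ↪ ι) × Fin r, f ∈ A → p.1 ∉ A ∧ (f p.2 = u ∨ f p.2 = v) ∧
      (∀ k, k ≠ p.2 → p.1 k = f k) ∧ ε ^ v₀ * -Δ f ≤ δ * Δ p.1 := by
    intro f
    by_cases hf : f ∈ A; swap
    · exact ⟨(f, ⟨0, hr⟩), fun h => absurd h hf⟩
    have hf' := hf
    simp only [A, Finset.mem_filter, Finset.mem_univ, true_and] at hf'
    obtain ⟨⟨i₀, hi₀⟩, ⟨j₀, hj₀⟩⟩ := hf'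
    have hij₀ : i₀ ≠ j₀ := by rintro rfl; exact huv (hi₀.symm.trans hj₀)
    -- The image of f without u and v has r - 2 elements. The part found outside it is larger than
    -- δ, hence also differs from u and v.
    obtain ⟨l, hlT, hl⟩ := hlarge (((Finset.univ.map f).erase u).erase v) (by
      have h1 : u ∈ Finset.univ.map f := by simp [← hi₀]
      have h2 : v ∈ (Finset.univ.map f).erase u :=
        Finset.mem_erase.2 ⟨huv.symm, by simp [← hj₀]⟩
      have h3 := Finset.card_erase_add_one h2
      have h4 := Finset.card_erase_add_one h1
      rw [Finset.card_map, Finset.card_univ, Fintype.card_fin] at h4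
      omega)
    have hlu : l ≠ u := by rintro rfl; linarith
    have hlv : l ≠ v := by rintro rfl; linarith
    have hlf : ∀ k, f k ≠ l := by
      rintro k rfl
      exact hlT (by simp [hlu, hlv])
    obtain ⟨i, j, hij, hor, haj⟩ : ∃ i j, i ≠ j ∧ ((f i = u ∧ f j = v) ∨ (f i = v ∧ f j = u)) ∧
        2 ≤ a j := by
      have := ha i₀
      have := ha j₀
      have := hinj.ne hij₀
      by_cases h : 2 ≤ a j₀
      · exact ⟨i₀, j₀, hij₀, Or.inl ⟨hi₀, hj₀⟩, h⟩
      · exact ⟨j₀, i₀, hij₀.symm, Or.inr ⟨hj₀, hi₀⟩, by omega⟩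
    let g : Fin r ↪ ι := f.trans (Equiv.swap (f i) l).toEmbedding
    have hgi : g i = l := by simp [g]
    have hgk : ∀ k, k ≠ i → g k = f k := fun k hk =>
      Equiv.swap_apply_of_ne_of_ne (fun h => hk (f.injective h)) (hlf k)
    have hCg : ε ^ v₀ * C f ≤ C g := by
      have h := partiteWeight_mul_of_agree (a := a) (z := replaceTwo y u v 1 1) hgk
      have hone : replaceTwo y u v 1 1 (f i) = 1 := by
        rcases hor with ⟨h, -⟩ | ⟨h, -⟩
        · rw [h, replaceTwo_left]
        · rw [h, replaceTwo_right _ huv]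
      rw [hone, hgi, replaceTwo_of_ne _ _ _ hlu hlv, one_pow, mul_one] at h
      have hpow : ε ^ v₀ ≤ y l ^ a i :=
        calc ε ^ v₀ ≤ y l ^ v₀ := pow_le_pow_left₀ hε.le hl _
          _ ≤ y l ^ a i := pow_le_pow_of_le_one (hy _) (hle1 _)
            (Finset.single_le_sum (f := a) (fun _ _ => Nat.zero_le _) (Finset.mem_univ i))
      change _ ≤ partiteWeight a (replaceTwo y u v 1 1) g
      rw [h, mul_comm]
      exact mul_le_mul_of_nonneg_left hpow (hC f)
    have hreal := pow_mul_pow_add_le hs0 ht0 hu hv hδ1 haj (ha i)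
    have hfin : ε ^ v₀ * (C f * (s ^ a i * t ^ a j + t ^ a i * s ^ a j)) ≤
        δ * (C g * ((s + t) ^ a j - s ^ a j - t ^ a j)) :=
      calc _ = (ε ^ v₀ * C f) * (s ^ a i * t ^ a j + t ^ a i * s ^ a j) := by ring
        _ ≤ C g * (δ * ((s + t) ^ a j - s ^ a j - t ^ a j)) :=
          mul_le_mul hCg hreal (by positivity) (hC g)
        _ = _ := by ring
    rcases hor with ⟨hi, hj⟩ | ⟨hi, hj⟩
    · have hgj : g j = v := by rw [hgk j hij.symm, hj]
      have hgu : ∀ k, g k ≠ u := by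
        intro k hk
        by_cases hki : k = i
        · exact hlu (by rw [← hgi, ← hki, hk])
        · exact hki (f.injective (by rw [← hgk k hki, hk, hi]))
      refine ⟨(g, i), fun _ => ⟨?_, Or.inl hi, hgk, ?_⟩⟩
      · simp [A, hgu]
      · dsimp only
        rw [hΔr hgj hgu, hΔb hi hj, neg_neg]
        exact hfin
    · have hgj : g j = u := by rw [hgk j hij.symm, hj]
      have hgv : ∀ k, g k ≠ v := by
        intro k hk
        by_cases hki : k = i
        · exact hlv (by rw [← hgi, ← hki, hk])
        · exact hki (f.injective (by rw [← hgk k hki, hk, hi]))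
      refine ⟨(g, i), fun _ => ⟨?_, Or.inr hi, hgk, ?_⟩⟩
      · simp [A, hgv]
      · dsimp only
        rw [hΔl hgj hgv, hΔb hj hi, neg_neg]
        refine le_of_eq_of_le ?_ hfin
        ring
  choose φ hφ' using hcharge
  have hφA := fun f hf => (hφ' f hf).1
  have hφuv := fun f hf => (hφ' f hf).2.1
  have hφk := fun f hf => (hφ' f hf).2.2.1
  have hφ := fun f hf => (hφ' f hf).2.2.2
  -- The target and the label determine f away from the moved index. There f takes whichever of u
  -- and v it does not take elsewhere.
  have hφinj : Set.InjOn φ (A : Set (Fin r ↪ ι)) := by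
    intro f₁ h₁ f₂ h₂ he
    have hk : ∀ k, k ≠ (φ f₁).2 → f₁ k = f₂ k := fun k hk => by
      rw [← hφk f₁ h₁ k hk, he, hφk f₂ h₂ k (he ▸ hk)]
    have hmem₁ := (Finset.mem_filter.1 (Finset.mem_coe.1 h₁)).2
    have e₁ := hφuv f₁ h₁
    have e₂ := hφuv f₂ h₂
    rw [← he] at e₂
    have hi : f₁ (φ f₁).2 = f₂ (φ f₁).2 := by
      rcases e₁ with e₁ | e₁ <;> rcases e₂ with e₂ | e₂
      · rw [e₁, e₂]
      · obtain ⟨j, hj⟩ := hmem₁.2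
        have hne : j ≠ (φ f₁).2 := by rintro rfl; exact huv (e₁.symm.trans hj)
        exact absurd (f₂.injective (((hk j hne).symm.trans hj).trans e₂.symm)) hne
      · obtain ⟨j, hj⟩ := hmem₁.1
        have hne : j ≠ (φ f₁).2 := by rintro rfl; exact huv (hj.symm.trans e₁)
        exact absurd (f₂.injective (((hk j hne).symm.trans hj).trans e₂.symm)) hne
      · rw [e₁, e₂]
    ext k
    by_cases h : k = (φ f₁).2
    · rw [h, hi]
    · exact hk k h
  have htot : 0 ≤ ∑ f, Δ f :=
    sum_nonneg_of_charge (pow_pos hε v₀) hδ0 (by rwa [Fintype.card_fin]) hφinj hφA hnn hφ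
  have h2 : 2 * partiteSum a (replaceTwo y u v (s + t) 0) - 2 * partiteSum a (replaceTwo y u v s t)
      = ∑ f, Δ f := by
    rw [two_mul_partiteSum_replaceTwo huv, two_mul_partiteSum_replaceTwo huv,
      ← Finset.sum_sub_distrib]
    refine Finset.sum_congr rfl fun f _ => ?_
    simp only [Δ, C, w]; ring
  rw [hself]
  linarith

end Merge

/-- The number of parts may be bounded in terms of a positive lower bound for the sum. -/
theorem exists_bounded_support {r : ℕ} (hr : 2 ≤ r) {a : Fin r → ℕ} (ha : ∀ i, 1 ≤ a i)
    (hinj : Function.Injective a) {μ : ℝ} (hμ : 0 < μ) :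
    ∃ L : ℕ, ∀ (ι : Type) [Fintype ι] [DecidableEq ι] (y : ι → ℝ), (∀ i, 0 ≤ y i) →
      ∑ i, y i = 1 → μ ≤ partiteSum a y → ∃ z : ι → ℝ, (∀ i, 0 ≤ z i) ∧ ∑ i, z i = 1 ∧
        (Finset.univ.filter fun i => z i ≠ 0).card ≤ L ∧ partiteSum a y ≤ partiteSum a z := by
  set ε := μ / 2 with hε
  have hε0 : 0 < ε := by positivity
  have hr0 : (0 : ℝ) < r := by exact_mod_cast (by omega : 0 < r)
  -- The three bounds are the ones required for merging: δ < ε, δ ≤ 1, and δ r at most the least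
  -- ratio guaranteed by moving an index to a large part.
  set δ := min (ε / 2) (min 1 (ε ^ (∑ i, a i) / r)) with hδ
  have hδ0 : 0 < δ := by positivity
  have hδ1 : δ ≤ 1 := (min_le_right _ _).trans (min_le_left _ _)
  have hδε : δ < ε := (min_le_left _ _).trans_lt (by linarith)
  have hδr : δ * r ≤ ε ^ ∑ i, a i :=
    (le_div_iff₀ hr0).1 ((min_le_right _ _).trans (min_le_right _ _))
  -- At most 1 / δ parts exceed δ, so a larger support contains two parts that can be merged, and
  -- the support shrinks.
  refine ⟨⌈1 / δ⌉₊ + 1, fun ι _ _ y => ?_⟩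
  induction hn : (Finset.univ.filter fun i => y i ≠ 0).card using Nat.strong_induction_on
    generalizing y with
  | _ n ih =>
  intro hy hy1 hE
  by_cases hnL : n ≤ ⌈1 / δ⌉₊ + 1
  · exact ⟨y, hy, hy1, hn ▸ hnL, le_rfl⟩
  set S := Finset.univ.filter fun i => y i ≠ 0 with hS
  have hbig : (S.filter fun i => ¬ y i ≤ δ).card ≤ ⌈1 / δ⌉₊ := by
    have h1 : ((S.filter fun i => ¬ y i ≤ δ).card : ℝ) * δ ≤ 1 := by
      rw [← hy1, ← nsmul_eq_mul]
      refine (Finset.card_nsmul_le_sum _ y δ fun i hi => ?_).trans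
        (Finset.sum_le_sum_of_subset_of_nonneg (Finset.subset_univ _) fun i _ _ => hy i)
      exact (not_le.1 (Finset.mem_filter.1 hi).2).le
    have h2 := (le_div_iff₀ hδ0).2 h1
    exact_mod_cast h2.trans (Nat.le_ceil _)
  have hcard := Finset.card_filter_add_card_filter_not (s := S) (fun i => y i ≤ δ)
  obtain ⟨u, hu, v, hv, huv⟩ := Finset.one_lt_card.1
    (show 1 < (S.filter fun i => y i ≤ δ).card by omega)
  simp only [Finset.mem_filter, hS, Finset.mem_univ, true_and] at hu hv
  set z := replaceTwo y u v (y u + y v) 0 with hz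
  have hle := partiteSum_le_merge (by omega) ha hinj hy
    (fun i => hy1 ▸ Finset.single_le_sum (fun j _ => hy j) (Finset.mem_univ i)) hε0
    (exists_large_part ha hinj hy hy1 hμ hE) hδ1 hδε hδr huv hu.2 hv.2
  have hzlt : (Finset.univ.filter fun i => z i ≠ 0).card < n := by
    rw [← hn]
    refine Finset.card_lt_card (Finset.ssubset_iff_of_subset ?_ |>.2 ⟨v, ?_, ?_⟩)
    · intro i hi
      simp only [Finset.mem_filter, Finset.mem_univ, true_and, hS] at hi ⊢
      by_cases hiu : i = u
      · rw [hiu]; exact hu.1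
      by_cases hiv : i = v
      · rw [hiv]; exact hv.1
      rwa [hz, replaceTwo_of_ne _ _ _ hiu hiv] at hi
    · simpa [hS] using hv.1
    · simp [hz, replaceTwo_right _ huv]
  obtain ⟨z', h1, h2, h3, h4⟩ := ih _ hzlt z rfl
    (replaceTwo_nonneg hy (add_nonneg (hy u) (hy v)) le_rfl)
    ((sum_replaceTwo y huv (add_zero _)).trans hy1) (hE.trans hle)
  exact ⟨z', h1, h2, h3, hle.trans h4⟩

/-! ### Weighted graphs and Zykov symmetrization -/

open Classical in
/-- The probability that random vertices of `H`, independent with law `y`, induce a copy of `F`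
(with vertices of `H` allowed to repeat). -/
noncomputable def homDensity {V W : Type*} [Fintype V] [DecidableEq V] [Fintype W]
    (F : SimpleGraph V) (H : SimpleGraph W) (y : W → ℝ) : ℝ :=
  ∑ q : V → W, if Nonempty (H.comap q ≃g F) then ∏ x, y (q x) else 0

section Symmetrization

variable {V W : Type*} [Fintype V] [DecidableEq V] [Fintype W] {F : SimpleGraph V}
  {H : SimpleGraph W} {y : W → ℝ} {u v : W}

open Classical in
/-- The map that identifies `v` with `u`. -/
noncomputable def identify (u v w : W) : W := if w = v then u else w

omit [Fintype V] [DecidableEq V] [Fintype W] in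
-- Non-adjacency is transitive in a copy of F. If the copy uses both of the non-adjacent vertices u
-- and v, they are twins towards all its vertices, so exchanging occurrences of u and v changes
-- nothing.
theorem comap_eq_of_identify_eq (hF : F.IsCompleteMultipartite) (huv : ¬ H.Adj u v)
    {q q' : V → W} (hq : Nonempty (H.comap q ≃g F)) {b c : V} (hb : q b = u) (hc : q c = v)
    (h : ∀ x, identify u v (q' x) = identify u v (q x)) : H.comap q' = H.comap q := by
  obtain ⟨φ⟩ := hq
  have htrans : ∀ x y z, ¬ H.Adj (q x) (q y) → ¬ H.Adj (q y) (q z) → ¬ H.Adj (q x) (q z) := by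
    intro x y z hxy hyz
    have h1 : ¬ F.Adj (φ x) (φ y) := fun hh => hxy (φ.map_adj_iff.1 hh)
    have h2 : ¬ F.Adj (φ y) (φ z) := fun hh => hyz (φ.map_adj_iff.1 hh)
    exact fun hh => hF.trans _ _ _ h1 h2 (φ.map_adj_iff.2 hh)
  have htwin : ∀ d, H.Adj u (q d) ↔ H.Adj v (q d) := by
    intro d
    rw [← not_iff_not, ← hb, ← hc]
    rw [← hb, ← hc] at huv
    exact ⟨fun hh => htrans _ _ _ (fun hx => huv hx.symm) hh, fun hh => htrans _ _ _ huv hh⟩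
  have key : ∀ p p', identify u v p = identify u v p' → ∀ d, H.Adj p (q d) ↔ H.Adj p' (q d) := by
    intro p p' hp d
    have := htwin d
    unfold identify at hp
    split_ifs at hp with h1 h2 h2 <;> simp_all
  have hrange : ∀ x, ∃ d, q' x = q d := by
    intro x
    have hx := h x
    unfold identify at hx
    split_ifs at hx with h1 h2 h2
    · exact ⟨c, h1.trans hc.symm⟩
    · exact ⟨c, h1.trans hc.symm⟩
    · exact ⟨b, hx.trans hb.symm⟩
    · exact ⟨x, hx⟩
  ext x z
  simp only [SimpleGraph.comap_adj]
  obtain ⟨d, hd⟩ := hrange x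
  rw [hd, H.adj_comm, key _ _ (h z), H.adj_comm, ← hd, key _ _ (h x)]

theorem homDensity_le_of_not_adj (hF : F.IsCompleteMultipartite) (hne : u ≠ v)
    (huv : ¬ H.Adj u v) (hy : ∀ i, 0 ≤ y i) (hm : 0 < y u + y v) :
    homDensity F H y ≤
      y u / (y u + y v) * homDensity F H (replaceTwo y u v (y u + y v) 0) +
      y v / (y u + y v) * homDensity F H (replaceTwo y u v 0 (y u + y v)) := by
  classical
  set m := y u + y v with hmdef
  set yu := replaceTwo y u v m 0 with hyu
  set yv := replaceTwo y u v 0 m with hyv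
  have hyu0 : ∀ i, 0 ≤ yu i := replaceTwo_nonneg hy hm.le le_rfl
  have hyv0 : ∀ i, 0 ≤ yv i := replaceTwo_nonneg hy le_rfl hm.le
  let good : (V → W) → Prop := fun q => Nonempty (H.comap q ≃g F)
  let term : (W → ℝ) → (V → W) → ℝ := fun z q => if good q then ∏ x, z (q x) else 0
  have hterm0 : ∀ z : W → ℝ, (∀ i, 0 ≤ z i) → ∀ q, 0 ≤ term z q := by
    intro z hz q
    simp only [term]
    split_ifs
    · exact Finset.prod_nonneg fun _ _ => hz _
    · exact le_rfl
  let π : (V → W) → (V → W) := fun q x => identify u v (q x)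
  have hfib : ∀ z, homDensity F H z = ∑ ρ, ∑ q with π q = ρ, term z q := fun z =>
    (Finset.sum_fiberwise Finset.univ π (term z)).symm
  -- The comparison is made on each class of samples that agree after v is identified with u.
  rw [hfib, hfib, hfib, Finset.mul_sum, Finset.mul_sum, ← Finset.sum_add_distrib]
  refine Finset.sum_le_sum fun ρ _ => ?_
  by_cases hρ : ∃ x, ρ x = v
  · obtain ⟨x, hx⟩ := hρ
    have hempty : (Finset.univ.filter fun q => π q = ρ) = ∅ := by
      refine Finset.filter_eq_empty_iff.2 fun q _ hq => ?_
      have := congrFun hq x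
      simp only [π, identify, hx] at this
      split_ifs at this
      exact hne this
      contradiction
    simp [hempty]
  push Not at hρ
  let ρv : V → W := fun x => if ρ x = u then v else ρ x
  have hπρ : π ρ = ρ := by ext x; simp [π, identify, hρ x]
  have hπρv : π ρv = ρ := by
    ext x
    simp only [π, identify, ρv]
    split_ifs <;> simp_all
  set P := ∏ x, yu (ρ x) with hP
  have hPv : ∏ x, yv (ρv x) = P := by
    refine Finset.prod_congr rfl fun x _ => ?_
    simp only [ρv]
    split_ifs with h
    · rw [h, hyv, hyu, replaceTwo_right _ hne, replaceTwo_left]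
    · rw [hyv, hyu, replaceTwo_of_ne _ _ _ h (hρ x), replaceTwo_of_ne _ _ _ h (hρ x)]
  have hru : (if good ρ then P else 0) ≤ ∑ q with π q = ρ, term yu q :=
    Finset.single_le_sum (f := term yu) (fun q _ => hterm0 _ hyu0 q) (by simpa using hπρ)
  have hrv : (if good ρv then P else 0) ≤ ∑ q with π q = ρ, term yv q := by
    rw [← hPv]
    exact Finset.single_le_sum (f := term yv) (fun q _ => hterm0 _ hyv0 q) (by simpa using hπρv)
  have hcu : 0 ≤ y u / m := div_nonneg (hy u) hm.le
  have hcv : 0 ≤ y v / m := div_nonneg (hy v) hm.le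
  refine le_trans ?_ (add_le_add (mul_le_mul_of_nonneg_left hru hcu)
    (mul_le_mul_of_nonneg_left hrv hcv))
  -- If goodness is constant on the class, the weights of its members add up to P. Otherwise no good
  -- member mixes u and v, leaving only the all-u and all-v samples.
  by_cases hX : ∀ q, π q = ρ → (good q ↔ good ρ)
  · have hsum : ∑ q with π q = ρ, ∏ x, y (q x) = P := by
      have : (Finset.univ.filter fun q => π q = ρ) =
          Fintype.piFinset fun x => Finset.univ.filter fun w => identify u v w = ρ x := by
        ext q
        simp [π, funext_iff]
      rw [this, ← Finset.prod_univ_sum]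
      refine Finset.prod_congr rfl fun x _ => ?_
      by_cases h : ρ x = u
      · have : (Finset.univ.filter fun w => identify u v w = u) = {u, v} := by
          ext w
          rw [Finset.mem_filter, identify, Finset.mem_insert, Finset.mem_singleton]
          split_ifs <;> simp_all
        rw [h, this, Finset.sum_pair hne, hyu, replaceTwo_left]
      · have : (Finset.univ.filter fun w => identify u v w = ρ x) = {ρ x} := by
          have := hρ x
          ext w
          rw [Finset.mem_filter, identify, Finset.mem_singleton]
          split_ifs <;> grind
        rw [this, Finset.sum_singleton, hyu, replaceTwo_of_ne _ _ _ h (hρ x)]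
    have hgv : good ρv ↔ good ρ := hX _ hπρv
    have hL : ∑ q with π q = ρ, term y q = if good ρ then P else 0 := by
      split_ifs with hg
      · rw [← hsum]
        refine Finset.sum_congr rfl fun q hq => ?_
        simp only [term, if_pos ((hX q (Finset.mem_filter.1 hq).2).2 hg)]
      · refine Finset.sum_eq_zero fun q hq => ?_
        simp only [term, if_neg (fun h => hg ((hX q (Finset.mem_filter.1 hq).2).1 h))]
    rw [hL, if_congr hgv rfl rfl, ← add_mul, ← add_div, ← hmdef, div_self hm.ne', one_mul]
  · push Not at hX
    obtain ⟨q₀, hq₀, hq₀'⟩ := hX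
    have hpure : ∀ q, π q = ρ → good q → q = ρ ∨ q = ρv := by
      intro q hq hg
      by_contra! hcon
      obtain ⟨b, hb⟩ := Function.ne_iff.1 hcon.2
      obtain ⟨c, hc⟩ := Function.ne_iff.1 hcon.1
      have hqb := congrFun hq b
      have hqc := congrFun hq c
      have hb' : q b = u := by
        simp only [π, identify, ρv] at hqb hb
        clear hcon hru hrv
        grind
      have hc' : q c = v := by
        simp only [π, identify] at hqc
        clear hcon hru hrv
        grind
      have hall : ∀ q', π q' = ρ → H.comap q' = H.comap q := fun q' h' =>
        comap_eq_of_identify_eq hF huv hg hb' hc' fun x => congrFun (h'.trans hq.symm) x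
      have e1 := hall q₀ hq₀
      have e2 := hall ρ hπρ
      have : good q₀ ↔ good ρ := by
        change Nonempty (H.comap q₀ ≃g F) ↔ Nonempty (H.comap ρ ≃g F)
        rw [e1, e2]
      tauto
    obtain ⟨x₀, hx₀⟩ : ∃ x, ρ x = u := by
      by_contra! hcon
      have : q₀ = ρ := by
        ext x
        have h1 := congrFun hq₀ x
        have h2 := hcon x
        simp only [π, identify] at h1
        split_ifs at h1 with h
        · exact absurd h1.symm h2
        · exact h1
      rw [this] at hq₀'
      tauto
    have hne' : ρ ≠ ρv := fun h => hne (by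
      have := congrFun h x₀
      simpa [ρv, hx₀] using this)
    have hle : ∀ x, ρ x ≠ u → y (ρ x) = yu (ρ x) := fun x hx => by
      rw [hyu, replaceTwo_of_ne _ _ _ hx (hρ x)]
    have hyuu : yu u = m := replaceTwo_left _ _ _ _ _
    -- One occurrence of u supplies the factor y u / m; at every other one y u ≤ m is enough.
    have hu1 : ∏ x, y (ρ x) ≤ y u / m * P := by
      rw [hP, ← Finset.mul_prod_erase _ _ (Finset.mem_univ x₀),
        ← Finset.mul_prod_erase _ (fun x => yu (ρ x)) (Finset.mem_univ x₀), ← mul_assoc, hx₀,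
        hyuu, div_mul_cancel₀ _ hm.ne']
      refine mul_le_mul_of_nonneg_left (Finset.prod_le_prod (fun _ _ => hy _) fun x _ => ?_) (hy u)
      by_cases h : ρ x = u
      · rw [h, hyuu, hmdef]; linarith [hy v]
      · exact (hle x h).le
    have hv1 : ∏ x, y (ρv x) ≤ y v / m * P := by
      rw [hP, ← Finset.mul_prod_erase _ _ (Finset.mem_univ x₀),
        ← Finset.mul_prod_erase _ (fun x => yu (ρ x)) (Finset.mem_univ x₀), ← mul_assoc, hx₀,
        hyuu, div_mul_cancel₀ _ hm.ne']
      have : ρv x₀ = v := by simp [ρv, hx₀]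
      rw [this]
      refine mul_le_mul_of_nonneg_left (Finset.prod_le_prod (fun _ _ => hy _) fun x _ => ?_) (hy v)
      simp only [ρv]
      split_ifs with h
      · rw [h, hyuu, hmdef]; linarith [hy u]
      · exact (hle x h).le
    have hsub : ∑ q with π q = ρ, term y q = term y ρ + term y ρv := by
      rw [← Finset.sum_pair hne']
      symm
      refine Finset.sum_subset ?_ fun q hq hq' => ?_
      · intro q hq
        rcases Finset.mem_insert.1 hq with rfl | hq
        · simpa using hπρ
        · rw [Finset.mem_singleton.1 hq]; simpa using hπρv
      · refine if_neg fun hg => hq' ?_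
        rcases hpure q (Finset.mem_filter.1 hq).2 hg with h | h <;> simp [h]
    rw [hsub]
    refine add_le_add ?_ ?_
    · simp only [term]
      split_ifs
      · exact hu1
      · simp
    · simp only [term]
      split_ifs
      · exact hv1
      · simp

/-- The weight can be moved onto a clique without decreasing the density of a complete
multipartite graph. -/
theorem exists_clique_support (hF : F.IsCompleteMultipartite) (H : SimpleGraph W)
    (hy : ∀ i, 0 ≤ y i) :
    ∃ z : W → ℝ, (∀ i, 0 ≤ z i) ∧ ∑ i, z i = ∑ i, y i ∧ homDensity F H y ≤ homDensity F H z ∧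
      H.IsClique {i | z i ≠ 0} := by
  classical
  induction hn : (Finset.univ.filter fun i => y i ≠ 0).card using Nat.strong_induction_on
    generalizing y with
  | _ n ih =>
  by_cases hcl : H.IsClique {i | y i ≠ 0}
  · exact ⟨y, hy, rfl, le_rfl, hcl⟩
  simp only [SimpleGraph.IsClique, Set.Pairwise] at hcl
  push Not at hcl
  obtain ⟨u, hu, v, hv, hne, huv⟩ := hcl
  simp only [Set.mem_ofPred_eq] at hu hv
  have hu0 : 0 < y u := lt_of_le_of_ne (hy u) (Ne.symm hu)
  have hv0 : 0 < y v := lt_of_le_of_ne (hy v) (Ne.symm hv)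
  have hm : 0 < y u + y v := by positivity
  have hle := homDensity_le_of_not_adj hF hne huv hy hm
  -- The density is bounded by a convex combination of the two extreme transfers, so one of them
  -- does not lower it.
  obtain ⟨s, t, hs, ht, hst, hzero, hT⟩ : ∃ s t, 0 ≤ s ∧ 0 ≤ t ∧ s + t = y u + y v ∧
      (s = 0 ∨ t = 0) ∧ homDensity F H y ≤ homDensity F H (replaceTwo y u v s t) := by
    by_contra! hcon
    have h1 := hcon (y u + y v) 0 hm.le le_rfl (add_zero _) (Or.inr rfl)
    have h2 := hcon 0 (y u + y v) le_rfl hm.le (zero_add _) (Or.inl rfl)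
    have hlt := add_lt_add (mul_lt_mul_of_pos_left h1 (div_pos hu0 hm))
      (mul_lt_mul_of_pos_left h2 (div_pos hv0 hm))
    rw [← add_mul, ← add_div, div_self hm.ne', one_mul] at hlt
    linarith
  have hlt : (Finset.univ.filter fun i => replaceTwo y u v s t i ≠ 0).card < n := by
    rw [← hn]
    refine Finset.card_lt_card ((Finset.ssubset_iff_of_subset fun i hi => ?_).2 ?_)
    · simp only [Finset.mem_filter, Finset.mem_univ, true_and] at hi ⊢
      by_cases hiu : i = u
      · rwa [hiu]
      by_cases hiv : i = v
      · rwa [hiv]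
      rwa [replaceTwo_of_ne _ _ _ hiu hiv] at hi
    · rcases hzero with h | h
      · exact ⟨u, by simpa using hu, by simp [replaceTwo_left, h]⟩
      · exact ⟨v, by simpa using hv, by simp [replaceTwo_right _ hne, h]⟩
  obtain ⟨z, h1, h2, h3, h4⟩ := ih _ hlt (replaceTwo_nonneg hy hs ht) rfl
  exact ⟨z, h1, h2.trans (sum_replaceTwo y hne hst), hT.trans h3, h4⟩

theorem homDensity_eq_top (hcl : H.IsClique {i | y i ≠ 0}) :
    homDensity F H y = homDensity F ⊤ y := by
  unfold homDensity
  refine Finset.sum_congr rfl fun q _ => ?_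
  by_cases h : ∏ x, y (q x) = 0
  · simp [h]
  · have hne : ∀ x, y (q x) ≠ 0 := fun x => Finset.prod_ne_zero_iff.1 h x (Finset.mem_univ x)
    have : H.comap q = (⊤ : SimpleGraph W).comap q := by
      ext x z
      simp only [SimpleGraph.comap_adj, SimpleGraph.top_adj]
      exact ⟨fun h => h.ne, fun h => hcl (hne x) (hne z) h⟩
    rw [this]

/-- Samples that meet a part of size zero contribute nothing, so empty parts may be dropped or added
freely. -/
theorem homDensity_top_comp {κ : Type*} [Fintype κ] (f : κ ↪ W)
    (hf : ∀ i, y i ≠ 0 → i ∈ Set.range f) :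
    homDensity F ⊤ (y ∘ f) = homDensity F ⊤ y := by
  unfold homDensity
  refine Finset.sum_of_injOn (fun q => f ∘ q) ?_ (by simp) ?_ ?_
  · exact (f.injective.comp_left).injOn
  · intro q _ hq
    have : ∃ x, y (q x) = 0 := by
      by_contra! hcon
      choose p hp using fun x => hf _ (hcon x)
      exact hq ⟨p, by simp, funext hp⟩
    obtain ⟨x, hx⟩ := this
    split_ifs
    · exact Finset.prod_eq_zero (Finset.mem_univ x) hx
    · rfl
  · intro q _
    have : (⊤ : SimpleGraph W).comap (f ∘ q) = (⊤ : SimpleGraph κ).comap q := by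
      ext x z
      simp [f.injective.eq_iff]
    rw [this]
    rfl

end Symmetrization

/-! ### The density of a complete partite graph as a polynomial -/

section CompletePartite

variable {r : ℕ} {a : Fin r → ℕ}

theorem completePartite_not_adj {x z : Σ i, Fin (a i)} :
    ¬ (completePartite a).Adj x z ↔ x.1 = z.1 := by
  simp [completePartite]

theorem isCompleteMultipartite_completePartite (a : Fin r → ℕ) :
    (completePartite a).IsCompleteMultipartite :=
  ⟨fun _ _ _ h h' => completePartite_not_adj.2
    ((completePartite_not_adj.1 h).trans (completePartite_not_adj.1 h'))⟩

/-- The partitions of `Σ i, Fin (a i)` into labelled parts of sizes `a i`. -/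
def labelledPartitions (a : Fin r → ℕ) : Finset ((Σ i, Fin (a i)) → Fin r) :=
  Finset.univ.filter fun d => ∀ i, (Finset.univ.filter fun x => d x = i).card = a i

theorem fst_mem_labelledPartitions (a : Fin r → ℕ) : Sigma.fst ∈ labelledPartitions a := by
  simp only [labelledPartitions, Finset.mem_filter, Finset.mem_univ, true_and]
  intro i
  have h : (Finset.univ.map ⟨Sigma.mk i, sigma_mk_injective⟩ :
      Finset (Σ i, Fin (a i))).card = a i := by
    rw [Finset.card_map, Finset.card_univ, Fintype.card_fin]
  refine Eq.trans ?_ h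
  congr 1
  ext ⟨j, x⟩
  simp only [Finset.mem_filter, Finset.mem_univ, true_and, Finset.mem_map,
    Function.Embedding.coeFn_mk]
  constructor
  · rintro rfl; exact ⟨x, rfl⟩
  · rintro ⟨z, hz⟩; exact (congrArg Sigma.fst hz).symm

/-- The classes of the copy are the fibres of c: d records the index of a class, f the part that
contains it. -/
theorem nonempty_comap_top_iso_iff {ι : Type*} (ha : ∀ i, 1 ≤ a i) (c : (Σ i, Fin (a i)) → ι) :
    Nonempty ((⊤ : SimpleGraph ι).comap c ≃g completePartite a) ↔
      ∃ f : Fin r ↪ ι, ∃ d ∈ labelledPartitions a, f ∘ d = c := by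
  classical
  constructor
  · rintro ⟨φ⟩
    have hφ : ∀ x z, c x = c z ↔ (φ x).1 = (φ z).1 := by
      intro x z
      rw [← completePartite_not_adj, φ.map_adj_iff]
      simp
    let b : Fin r → Σ i, Fin (a i) := fun i => φ.symm ⟨i, ⟨0, ha i⟩⟩
    have hb : ∀ i, (φ (b i)).1 = i := fun i => by simp [b]
    refine ⟨⟨fun i => c (b i), fun i j h => ?_⟩, fun x => (φ x).1, ?_, ?_⟩
    · rw [← hb i, ← hb j]; exact (hφ _ _).1 h
    · have h := fst_mem_labelledPartitions a
      simp only [labelledPartitions, Finset.mem_filter, Finset.mem_univ, true_and] at h ⊢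
      intro i
      rw [← h i]
      exact Finset.card_equiv φ.toEquiv (by simp)
    · ext x
      exact (hφ _ _).2 (hb _)
  · rintro ⟨f, d, hd, rfl⟩
    simp only [labelledPartitions, Finset.mem_filter, Finset.mem_univ, true_and] at hd
    let e : ∀ i, {x // d x = i} ≃ Fin (a i) := fun i =>
      Fintype.equivFinOfCardEq (by rw [Fintype.card_subtype, hd i])
    let φ : (Σ i, Fin (a i)) ≃ Σ i, Fin (a i) :=
      (Equiv.sigmaFiberEquiv d).symm.trans (Equiv.sigmaCongrRight fun i => e i)
    have hφ : ∀ x, (φ x).1 = d x := fun x => rfl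
    refine ⟨⟨φ, ?_⟩⟩
    intro x z
    rw [← not_iff_not, completePartite_not_adj, hφ, hφ]
    simp

/-- Every good sample factors as f ∘ d. Since the fibres have the pairwise distinct sizes `a i`, the
size of a fibre reveals its index and the factorization is unique. -/
theorem homDensity_completePartite {ι : Type*} [Fintype ι] (ha : ∀ i, 1 ≤ a i)
    (hinj : Function.Injective a) (y : ι → ℝ) :
    homDensity (completePartite a) ⊤ y = (labelledPartitions a).card * partiteSum a y := by
  classical
  unfold partiteSum
  rw [Finset.mul_sum]
  have hcard : ∀ {d}, d ∈ labelledPartitions a →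
      ∀ i, (Finset.univ.filter fun x => d x = i).card = a i := fun hd => (Finset.mem_filter.1 hd).2
  have h1 : ∑ f : Fin r ↪ ι, ((labelledPartitions a).card : ℝ) * partiteWeight a y f =
      ∑ p ∈ (Finset.univ : Finset (Fin r ↪ ι)) ×ˢ labelledPartitions a, partiteWeight a y p.1 := by
    rw [Finset.sum_product]
    refine Finset.sum_congr (by congr!) fun f _ => ?_
    simp only [Finset.sum_const, nsmul_eq_mul]
  rw [h1]
  symm
  unfold homDensity
  refine Finset.sum_of_injOn (fun p => p.1 ∘ p.2) ?_ (by simp) ?_ ?_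
  · rintro ⟨f, d⟩ hp ⟨f', d'⟩ hp' h
    simp only [Finset.coe_product, Finset.coe_univ, Set.mem_prod, Finset.mem_coe] at hp hp'
    have hd := hcard hp.2
    have hd' := hcard hp'.2
    dsimp only at h hd hd'
    have hff : ∀ i, f i = f' i := by
      intro i
      have hpos : 0 < (Finset.univ.filter fun x => d x = i).card := by rw [hd i]; exact ha i
      obtain ⟨x, hx⟩ := Finset.card_pos.1 hpos
      simp only [Finset.mem_filter, Finset.mem_univ, true_and] at hx
      have hfx : f i = f' (d' x) := by rw [← hx]; exact congrFun h x
      have : a i = a (d' x) := by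
        rw [← hd i, ← hd' (d' x)]
        congr 1
        ext z
        simp only [Finset.mem_filter, Finset.mem_univ, true_and]
        rw [← f.injective.eq_iff, ← f'.injective.eq_iff, ← hfx]
        have := congrFun h z
        simp only [Function.comp] at this
        rw [this]
      rw [hfx, ← hinj this]
    have hf : f = f' := by ext i; exact hff i
    subst hf
    rw [f.injective.comp_left h]
  · intro q _ hq
    rw [if_neg]
    rw [nonempty_comap_top_iso_iff ha]
    rintro ⟨f, d, hd, rfl⟩
    exact hq ⟨(f, d), by simpa using hd, rfl⟩
  · rintro ⟨f, d⟩ hp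
    have hd : d ∈ labelledPartitions a := by simpa using hp
    rw [if_pos ((nonempty_comap_top_iso_iff ha _).2 ⟨f, d, hd, rfl⟩)]
    unfold partiteWeight
    rw [← Finset.prod_fiberwise Finset.univ d]
    refine Finset.prod_congr rfl fun i _ => ?_
    rw [← hcard hd i, ← Finset.prod_const]
    refine Finset.prod_congr rfl fun x hx => ?_
    simp [(Finset.mem_filter.1 hx).2]

end CompletePartite

/-! ### Finite graphs and sampling -/

section Counting

variable {V W : Type*} [Fintype V] [DecidableEq V] [Fintype W] [DecidableEq W]
  {F : SimpleGraph V} {G : SimpleGraph W}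

omit [DecidableEq V] [Fintype W] [DecidableEq W] in
theorem nonempty_comap_iso_iff (e : V ↪ W) :
    Nonempty (G.comap e ≃g F) ↔
      Nonempty (G.induce ((Finset.univ.map e : Finset W) : Set W) ≃g F) := by
  let φ : V ≃ ((Finset.univ.map e : Finset W) : Set W) :=
    Equiv.ofBijective (fun x => ⟨e x, by simp⟩)
      ⟨fun x z h => e.injective (congrArg Subtype.val h), by rintro ⟨w, hw⟩; simpa using hw⟩
  let ψ : G.comap e ≃g G.induce ((Finset.univ.map e : Finset W) : Set W) :=
    ⟨φ, Iff.rfl⟩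
  exact ⟨fun ⟨θ⟩ => ⟨ψ.symm.trans θ⟩, fun ⟨θ⟩ => ⟨ψ.trans θ⟩⟩

open Classical in
-- The embeddings with a given image S are the bijections from V to S, and whether they are counted
-- depends only on S.
theorem card_filter_embedding (F : SimpleGraph V) (G : SimpleGraph W) :
    (Finset.univ.filter fun e : V ↪ W => Nonempty (G.comap e ≃g F)).card =
      (Fintype.card V).factorial * inducedCount F G := by
  set 𝒮 : Finset (Finset W) := Finset.univ.filter fun S =>
    S.card = Fintype.card V ∧ Nonempty (G.induce (S : Set W) ≃g F) with h𝒮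
  have hcount : inducedCount F G = 𝒮.card := by
    unfold inducedCount
    rw [← Set.ncard_coe_finset]
    congr 1
    ext S
    simp [h𝒮]
  rw [hcount, Finset.card_eq_sum_card_fiberwise (f := fun e : V ↪ W => Finset.univ.map e) (t := 𝒮)]
  · rw [mul_comm, ← smul_eq_mul, ← Finset.sum_const]
    refine Finset.sum_congr rfl fun S hS => ?_
    obtain ⟨hcard, hS⟩ := (Finset.mem_filter.1 hS).2
    have e₀ : V ≃ S := Fintype.equivOfCardEq (by rw [Fintype.card_coe, hcard])
    rw [← Fintype.card_equiv e₀, ← Finset.card_univ]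
    symm
    refine Finset.card_bij (fun φ _ => φ.toEmbedding.trans (Function.Embedding.subtype _)) ?_ ?_ ?_
    · intro φ _
      have himg : Finset.univ.map (φ.toEmbedding.trans (Function.Embedding.subtype (· ∈ S))) = S := by
        rw [← Finset.map_map, Finset.map_univ_equiv]
        ext w; simp
      rw [Finset.mem_filter, Finset.mem_filter]
      refine ⟨⟨Finset.mem_univ _, ?_⟩, himg⟩
      rw [nonempty_comap_iso_iff, himg]
      exact hS
    · intro φ _ ψ _ h
      ext x
      exact DFunLike.congr_fun h x
    · intro e he
      rw [Finset.mem_filter] at he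
      have himg := he.2
      have hmem : ∀ x, e x ∈ S := fun x => himg ▸ Finset.mem_map_of_mem e (Finset.mem_univ x)
      refine ⟨Equiv.ofBijective (fun x => ⟨e x, hmem x⟩)
        ⟨fun x z h => e.injective (congrArg Subtype.val h), ?_⟩, Finset.mem_univ _, ?_⟩
      · rintro ⟨w, hw⟩
        rw [← himg] at hw
        obtain ⟨x, -, hx⟩ := Finset.mem_map.1 hw
        exact ⟨x, Subtype.ext hx⟩
      · ext x; rfl
  · intro e he
    have he := (Finset.mem_filter.1 (Finset.mem_coe.1 he)).2
    refine Finset.mem_coe.2 (Finset.mem_filter.2 ⟨Finset.mem_univ _, ?_, ?_⟩)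
    · rw [Finset.card_map, Finset.card_univ]
    · exact (nonempty_comap_iso_iff e).1 he

open Classical in
theorem inducedDensity_eq (F : SimpleGraph V) (G : SimpleGraph W) :
    inducedDensity F G =
      ((Finset.univ.filter fun e : V ↪ W => Nonempty (G.comap e ≃g F)).card : ℝ) /
        ((Fintype.card W).descFactorial (Fintype.card V) : ℝ) := by
  unfold inducedDensity
  rw [card_filter_embedding, Nat.descFactorial_eq_factorial_mul_choose]
  push_cast
  rw [mul_div_mul_left]
  exact_mod_cast (Nat.factorial_pos _).ne'

/-- The induced density is at most that of the uniform blow-up, up to the effect of repeated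
vertices. -/
theorem inducedDensity_le_homDensity (F : SimpleGraph V) (G : SimpleGraph W)
    (hW : 0 < Fintype.card W) :
    inducedDensity F G ≤ homDensity F G (fun _ => (Fintype.card W : ℝ)⁻¹) *
      ((Fintype.card W : ℝ) ^ Fintype.card V /
        ((Fintype.card W).descFactorial (Fintype.card V) : ℝ)) := by
  classical
  have hn : (0 : ℝ) < Fintype.card W := by exact_mod_cast hW
  rw [inducedDensity_eq, ← mul_div_assoc]
  refine div_le_div_of_nonneg_right ?_ (Nat.cast_nonneg _)
  have hT : homDensity F G (fun _ => (Fintype.card W : ℝ)⁻¹) * (Fintype.card W : ℝ) ^ Fintype.card V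
      = (Finset.univ.filter fun q : V → W => Nonempty (G.comap q ≃g F)).card := by
    unfold homDensity
    simp only [Finset.prod_const, Finset.card_univ]
    rw [← Finset.sum_filter, Finset.sum_const, nsmul_eq_mul, mul_assoc, ← mul_pow,
      inv_mul_cancel₀ hn.ne', one_pow, mul_one]
  rw [hT]
  exact_mod_cast Finset.card_le_card_of_injOn (fun e : V ↪ W => (e : V → W))
    (fun e he => by simpa using he) DFunLike.coe_injective.injOn

omit [DecidableEq V] in
theorem sum_prod_of_comp_eq {κ : Type*} [Fintype κ] [DecidableEq κ] {x : κ → ℝ}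
    (hx : ∑ i, x i = 1) (e : V ↪ W) (ρ : V → κ) :
    ∑ q : W → κ with q ∘ e = ρ, ∏ j, x (q j) = ∏ v, x (ρ v) := by
  have h : (Finset.univ.filter fun q : W → κ => q ∘ e = ρ) =
      Fintype.piFinset fun j => Finset.univ.filter fun i => ∀ v, e v = j → i = ρ v := by
    ext q
    simp only [Finset.mem_filter, Finset.mem_univ, true_and, Fintype.mem_piFinset, funext_iff,
      Function.comp]
    exact ⟨fun h j v hv => hv ▸ h v, fun h v => h _ v rfl⟩
  rw [h, ← Finset.prod_univ_sum, ← Finset.prod_subset (Finset.subset_univ (Finset.univ.map e)),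
    Finset.prod_map]
  · refine Finset.prod_congr rfl fun v _ => ?_
    have : (Finset.univ.filter fun i => ∀ w, e w = e v → i = ρ w) = {ρ v} := by
      ext i
      rw [Finset.mem_filter, Finset.mem_singleton]
      exact ⟨fun h => h.2 v rfl,
        fun h => ⟨Finset.mem_univ _, fun w hw => by rw [h, e.injective hw]⟩⟩
    rw [this, Finset.sum_singleton]
  · intro j _ hj
    rw [Finset.filter_true_of_mem, hx]
    intro i _ v hv
    exact absurd (by rw [← hv]; simp) hj

/-- Sampling: the density in a weighted graph is at most the largest induced density in its
finite samples. -/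
theorem homDensity_le_of_samples {κ : Type*} [Fintype κ] (F : SimpleGraph V)
    (H : SimpleGraph κ) {x : κ → ℝ} (hx0 : ∀ i, 0 ≤ x i) (hx : ∑ i, x i = 1)
    (hcard : Fintype.card V ≤ Fintype.card W) {B : ℝ}
    (hB : ∀ q : W → κ, inducedDensity F (H.comap q) ≤ B) : homDensity F H x ≤ B := by
  classical
  have hD : (0 : ℝ) < ((Fintype.card W).descFactorial (Fintype.card V) : ℝ) := by
    exact_mod_cast Nat.descFactorial_pos.2 hcard
  have hw : ∑ q : W → κ, ∏ j, x (q j) = 1 := by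
    have := Finset.prod_univ_sum (fun _ : W => (Finset.univ : Finset κ)) (fun _ i => x i)
    rw [Fintype.piFinset_univ] at this
    rw [← this]
    simp [hx]
  have hmarg : ∀ e : V ↪ W, ∑ q : W → κ, (if Nonempty (H.comap (q ∘ e) ≃g F) then
      ∏ j, x (q j) else 0) = homDensity F H x := by
    intro e
    unfold homDensity
    rw [← Finset.sum_fiberwise Finset.univ (fun q : W → κ => q ∘ e)]
    refine Finset.sum_congr rfl fun ρ _ => ?_
    rw [← sum_prod_of_comp_eq hx e ρ]
    split_ifs with hρ
    · refine Finset.sum_congr rfl fun q hq => ?_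
      rw [(Finset.mem_filter.1 hq).2, if_pos hρ]
    · refine Finset.sum_eq_zero fun q hq => ?_
      rw [(Finset.mem_filter.1 hq).2, if_neg hρ]
  -- The expected induced density of a random sample is exactly the weighted density, because every
  -- embedding of V sees independent vertices of law x.
  have hmain : homDensity F H x = ∑ q : W → κ, (∏ j, x (q j)) * inducedDensity F (H.comap q) := by
    have h1 : ∀ q : W → κ, (∏ j, x (q j)) * inducedDensity F (H.comap q) =
        (∑ e : V ↪ W, if Nonempty (H.comap (q ∘ e) ≃g F) then ∏ j, x (q j) else 0) /
          ((Fintype.card W).descFactorial (Fintype.card V) : ℝ) := by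
      intro q
      rw [inducedDensity_eq, ← Finset.sum_filter, Finset.sum_const, nsmul_eq_mul, ← mul_div_assoc,
        mul_comm]
      rfl
    rw [Finset.sum_congr rfl fun q _ => h1 q, ← Finset.sum_div, Finset.sum_comm,
      Finset.sum_congr rfl fun e _ => hmarg e, Finset.sum_const, Finset.card_univ,
      Fintype.card_embedding_eq, nsmul_eq_mul, mul_div_cancel_left₀ _ hD.ne']
  rw [hmain]
  calc _ ≤ ∑ q : W → κ, (∏ j, x (q j)) * B := Finset.sum_le_sum fun q _ =>
        mul_le_mul_of_nonneg_left (hB q) (Finset.prod_nonneg fun _ _ => hx0 _)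
    _ = B := by rw [← Finset.sum_mul, hw, one_mul]

end Counting

/-! ### Complete partite graphons -/

section Graphon

variable {l : ℕ} {x : Fin l → ℝ}

theorem volume_interval (hx : x ∈ stdSimplex ℝ (Fin l)) (i : Fin l) :
    volume.real (interval x i) = x i := by
  have h0 : 0 ≤ ∑ j ∈ Finset.Iio i, x j := Finset.sum_nonneg fun j _ => hx.1 j
  have h1 : ∑ j ∈ Finset.Iic i, x j ≤ 1 := hx.2 ▸
    Finset.sum_le_sum_of_subset_of_nonneg (Finset.subset_univ _) fun j _ _ => hx.1 j
  have h2 : ∑ j ∈ Finset.Iic i, x j = ∑ j ∈ Finset.Iio i, x j + x i := by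
    rw [← Finset.Iio_insert, Finset.sum_insert (by simp), add_comm]
  have himg : ((↑) : I → ℝ) '' interval x i =
      Set.Ico (∑ j ∈ Finset.Iio i, x j) (∑ j ∈ Finset.Iic i, x j) := by
    ext t
    constructor
    · rintro ⟨s, hs, rfl⟩; exact hs
    · intro ht
      exact ⟨⟨t, h0.trans ht.1, ht.2.le.trans h1⟩, ht, rfl⟩
  rw [measureReal_def, Measure.Subtype.volume_def, comap_subtype_coe_apply measurableSet_Icc, himg,
    Real.volume_Ico, h2, add_sub_cancel_left, ENNReal.toReal_ofReal (hx.1 i)]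

theorem interval_disjoint (hx : x ∈ stdSimplex ℝ (Fin l)) {i j : Fin l} (hij : i ≠ j) :
    Disjoint (interval x i) (interval x j) := by
  wlog h : i < j generalizing i j
  · exact (this hij.symm (lt_of_le_of_ne (not_lt.1 h) hij.symm)).symm
  refine Set.disjoint_left.2 fun t hi hj => ?_
  have : ∑ k ∈ Finset.Iic i, x k ≤ ∑ k ∈ Finset.Iio j, x k :=
    Finset.sum_le_sum_of_subset_of_nonneg
      (fun k hk => Finset.mem_Iio.2 ((Finset.mem_Iic.1 hk).trans_lt h)) fun k _ _ => hx.1 k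
  exact absurd (hi.2.trans_le (this.trans hj.1)) (lt_irrefl _)

theorem ae_exists_mem_interval (hx : x ∈ stdSimplex ℝ (Fin l)) :
    ∀ᵐ t : I, ∃ i, t ∈ interval x i := by
  have hU : volume.real (⋃ i, interval x i) = 1 := by
    have h := measureReal_biUnion_finset (μ := (volume : Measure I)) (s := Finset.univ)
      (f := interval x) (fun i _ j _ hij => interval_disjoint hx hij)
      (fun i _ => measurableSet_interval x i)
    simp only [Finset.mem_univ, Set.iUnion_true] at h
    rw [h, Finset.sum_congr rfl fun i _ => volume_interval hx i, hx.2]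
  have hU' : volume (⋃ i, interval x i) = 1 := by
    rw [measureReal_def] at hU
    exact (ENNReal.toReal_eq_one_iff _).1 hU
  have hm : MeasurableSet (⋃ i, interval x i) :=
    MeasurableSet.iUnion fun i => measurableSet_interval x i
  rw [← prob_compl_eq_zero_iff hm] at hU'
  filter_upwards [compl_mem_ae_iff.2 hU'] with t ht
  simpa using ht

theorem inducedGraph_completePartiteGraphon (hx : x ∈ stdSimplex ℝ (Fin l)) {V : Type*}
    {p : V → I} {c : V → Fin l} (hc : ∀ v, p v ∈ interval x (c v)) :
    (completePartiteGraphon x).inducedGraph p = (⊤ : SimpleGraph (Fin l)).comap c := by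
  have huniq : ∀ {v i}, p v ∈ interval x i → i = c v := by
    intro v i hi
    by_contra h
    exact Set.disjoint_left.1 (interval_disjoint hx h) hi (hc v)
  ext v w
  simp only [Graphon.inducedGraph, completePartiteGraphon, SimpleGraph.comap_adj,
    SimpleGraph.top_adj]
  constructor
  · rintro ⟨-, h⟩
    split_ifs at h with hex
    · obtain ⟨i, j, hij, hi, hj⟩ := hex
      rwa [huniq hi, huniq hj] at hij
    · simp at h
  · intro h
    exact ⟨fun hvw => h (by rw [hvw]), if_pos ⟨_, _, h, hc v, hc w⟩⟩

/-- Up to a null set, the event is a disjoint union of boxes, one for each good assignment of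
vertices to intervals. -/
theorem inducedDensity_completePartiteGraphon (hx : x ∈ stdSimplex ℝ (Fin l)) {V : Type*}
    [Fintype V] [DecidableEq V] (F : SimpleGraph V) :
    (completePartiteGraphon x).inducedDensity F = homDensity F ⊤ x := by
  classical
  let S : Finset (V → Fin l) :=
    Finset.univ.filter fun c => Nonempty ((⊤ : SimpleGraph (Fin l)).comap c ≃g F)
  let R : (V → Fin l) → Set (V → I) := fun c => Set.pi Set.univ fun v => interval x (c v)
  have hae : ∀ᵐ p : V → I, ∀ v, ∃ i, p v ∈ interval x i := by
    refine eventually_all.2 fun v => ?_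
    exact (Measure.quasiMeasurePreserving_eval (fun _ : V => (volume : Measure I)) v).ae
      (ae_exists_mem_interval hx)
  have hset : {p : V → I | Nonempty ((completePartiteGraphon x).inducedGraph p ≃g F)} =ᵐ[volume]
      ⋃ c ∈ S, R c := by
    filter_upwards [hae] with p hp
    choose c hc using hp
    apply propext
    change Nonempty ((completePartiteGraphon x).inducedGraph p ≃g F) ↔ p ∈ ⋃ c ∈ S, R c
    simp only [Set.mem_iUnion, exists_prop, S, R, Finset.mem_filter, Finset.mem_univ, true_and,
      Set.mem_pi]
    constructor
    · intro h
      rw [inducedGraph_completePartiteGraphon hx hc] at h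
      exact ⟨c, h, fun v _ => hc v⟩
    · rintro ⟨c', h, hc'⟩
      rwa [inducedGraph_completePartiteGraphon hx fun v => hc' v trivial]
  unfold Graphon.inducedDensity homDensity
  rw [measureReal_congr hset, measureReal_biUnion_finset, ← Finset.sum_filter]
  · refine Finset.sum_congr rfl fun c _ => ?_
    rw [measureReal_def, volume_pi_pi, ENNReal.toReal_prod]
    exact Finset.prod_congr rfl fun v _ => volume_interval hx (c v)
  · intro c _ c' _ hcc
    obtain ⟨v, hv⟩ := Function.ne_iff.1 hcc
    exact Set.disjoint_left.2 fun p hp hp' => Set.disjoint_left.1 (interval_disjoint hx hv)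
      (hp v (Set.mem_univ v)) (hp' v (Set.mem_univ v))
  · exact fun c _ => MeasurableSet.univ_pi fun v => measurableSet_interval x (c v)

end Graphon

/-! ### Maximizers and limits -/

section Maximizer

variable {V : Type*} [Fintype V] [DecidableEq V] {F : SimpleGraph V}

theorem sum_comp_embedding {κ W : Type*} [Fintype κ] [Fintype W] {y : W → ℝ} (f : κ ↪ W)
    (hf : ∀ i, y i ≠ 0 → i ∈ Set.range f) : ∑ k, y (f k) = ∑ i, y i := by
  refine Finset.sum_of_injOn f f.injective.injOn (by simp) (fun i _ hi => ?_) fun _ _ => rfl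
  by_contra h
  obtain ⟨k, hk⟩ := hf i h
  exact hi ⟨k, by simp, hk⟩

theorem exists_pos_stdSimplex {W : Type*} [Fintype W] [DecidableEq W] {y : W → ℝ}
    (hy : ∀ i, 0 ≤ y i) (hy1 : ∑ i, y i = 1) :
    ∃ x ∈ stdSimplex ℝ (Fin (Finset.univ.filter fun i => y i ≠ 0).card), (∀ i, 0 < x i) ∧
      homDensity F ⊤ x = homDensity F ⊤ y := by
  set S := Finset.univ.filter fun i => y i ≠ 0 with hS
  let f : Fin S.card ↪ W := S.equivFin.symm.toEmbedding.trans (Function.Embedding.subtype _)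
  have hf : ∀ i, y i ≠ 0 → i ∈ Set.range f := fun i hi =>
    ⟨S.equivFin ⟨i, by simpa [hS] using hi⟩, by simp [f]⟩
  have hpos : ∀ i, 0 < y (f i) := fun i =>
    lt_of_le_of_ne (hy _) (Ne.symm (Finset.mem_filter.1 (S.equivFin.symm i).2).2)
  exact ⟨y ∘ f, ⟨fun i => (hpos i).le, (sum_comp_embedding f hf).trans hy1⟩, hpos,
    homDensity_top_comp f hf⟩

theorem exists_extend_stdSimplex {l m : ℕ} (h : l ≤ m) {x : Fin l → ℝ}
    (hx : x ∈ stdSimplex ℝ (Fin l)) :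
    ∃ z ∈ stdSimplex ℝ (Fin m), homDensity F ⊤ z = homDensity F ⊤ x := by
  let f : Fin l ↪ Fin m := Fin.castLEEmb h
  let z : Fin m → ℝ := Function.extend f x 0
  have hzf : ∀ i, z (f i) = x i := fun i => f.injective.extend_apply x 0 i
  have hz : ∀ i, z i ≠ 0 → i ∈ Set.range f := by
    intro i hi
    by_contra hcon
    exact hi (Function.extend_apply' _ _ _ hcon)
  have hcomp : z ∘ f = x := funext hzf
  refine ⟨z, ⟨fun i => ?_, ?_⟩, ?_⟩
  · by_cases hi : z i = 0
    · exact hi.ge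
    · obtain ⟨k, rfl⟩ := hz i hi
      exact hzf k ▸ hx.1 k
  · rw [← sum_comp_embedding f hz, ← hx.2]
    exact Finset.sum_congr rfl fun i _ => hzf i
  · rw [← homDensity_top_comp f hz, hcomp]

theorem continuous_homDensity {W : Type*} [Fintype W] (F : SimpleGraph V) (H : SimpleGraph W) :
    Continuous fun y : W → ℝ => homDensity F H y := by
  unfold homDensity
  refine continuous_finsetSum _ fun q _ => ?_
  split_ifs
  · fun_prop
  · fun_prop

/-- Among weights with at most `m` parts the density is maximized by some point of the simplex. -/
theorem exists_maximizer (F : SimpleGraph V) {m : ℕ} (hm : 0 < m) :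
    ∃ x ∈ stdSimplex ℝ (Fin m), ∀ {W : Type} [Fintype W] [DecidableEq W] (y : W → ℝ),
      (∀ i, 0 ≤ y i) → ∑ i, y i = 1 → (Finset.univ.filter fun i => y i ≠ 0).card ≤ m →
        homDensity F ⊤ y ≤ homDensity F ⊤ x := by
  have hne : (stdSimplex ℝ (Fin m)).Nonempty :=
    ⟨_, single_mem_stdSimplex ℝ (⟨0, hm⟩ : Fin m)⟩
  obtain ⟨x, hx, hmax⟩ := (isCompact_stdSimplex ℝ (Fin m)).exists_isMaxOn hne
    (continuous_homDensity F ⊤).continuousOn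
  refine ⟨x, hx, fun y hy hy1 hcard => ?_⟩
  obtain ⟨y', hy', -, he⟩ := exists_pos_stdSimplex (F := F) hy hy1
  obtain ⟨z, hz, hez⟩ := exists_extend_stdSimplex (F := F) hcard hy'
  rw [← he, ← hez]
  exact hmax hz

/-- The squeeze that determines the limit of the maximum induced densities. -/
theorem tendsto_iSup_inducedDensity {ι : ℕ → Type} [∀ n, Finite (ι n)] [∀ n, Nonempty (ι n)]
    (g : ∀ n, ι n → SimpleGraph (Fin n)) {m : ℕ} {x : Fin m → ℝ}
    (hx : x ∈ stdSimplex ℝ (Fin m))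
    (hsample : ∀ n (q : Fin n → Fin m), ∃ i, g n i = (⊤ : SimpleGraph (Fin m)).comap q)
    (hub : ∀ n, 0 < n → ∀ i (y : Fin n → ℝ), (∀ j, 0 ≤ y j) → ∑ j, y j = 1 →
      homDensity F (g n i) y ≤ homDensity F ⊤ x) :
    Tendsto (fun n => ⨆ i, inducedDensity F (g n i)) atTop (𝓝 (homDensity F ⊤ x)) := by
  set v := Fintype.card V
  -- Repeated vertices in a sample become negligible as n grows.
  have hratio : Tendsto (fun n : ℕ => (n : ℝ) ^ v / (n.descFactorial v : ℝ)) atTop (𝓝 1) := by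
    refine (Asymptotics.isEquivalent_iff_tendsto_one ?_).1 (isEquivalent_descFactorial v).symm
    filter_upwards [eventually_ge_atTop v] with n hn
    exact_mod_cast (Nat.descFactorial_pos.2 hn).ne'
  have hup : Tendsto (fun n : ℕ => homDensity F ⊤ x * ((n : ℝ) ^ v / (n.descFactorial v : ℝ)))
      atTop (𝓝 (homDensity F ⊤ x)) := by
    simpa using hratio.const_mul (homDensity F ⊤ x)
  refine tendsto_of_tendsto_of_tendsto_of_le_of_le' tendsto_const_nhds hup ?_ ?_
  · filter_upwards [eventually_ge_atTop v] with n hn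
    refine homDensity_le_of_samples (W := Fin n) F ⊤ hx.1 hx.2 (by simpa using hn) fun q => ?_
    obtain ⟨i, hi⟩ := hsample n q
    rw [← hi]
    exact le_ciSup (f := fun i => inducedDensity F (g n i)) (Set.finite_range _).bddAbove i
  · filter_upwards [eventually_gt_atTop 0] with n hn
    refine ciSup_le fun i => ?_
    have hn' : (0 : ℝ) < n := by exact_mod_cast hn
    have h := inducedDensity_le_homDensity F (g n i) (by simpa using hn)
    rw [Fintype.card_fin] at h
    refine h.trans (mul_le_mul_of_nonneg_right (hub n hn i _ (fun _ => by positivity) ?_)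
      (by positivity))
    simp [hn'.ne']

end Maximizer

/-! ### Optimal weights for strongly unbalanced graphs -/

section StronglyUnbalanced

variable {r : ℕ} {a : Fin r → ℕ}

theorem partiteSum_uniform_pos (hr : 2 ≤ r) :
    0 < partiteSum a (fun _ : Fin r => (r : ℝ)⁻¹) := by
  have hr0 : (0 : ℝ) < r := by exact_mod_cast (by omega : 0 < r)
  exact Finset.sum_pos (fun f _ => Finset.prod_pos fun i _ => by positivity)
    ⟨Function.Embedding.refl _, Finset.mem_univ _⟩

theorem labelledPartitions_card_pos (a : Fin r → ℕ) : (0 : ℝ) < (labelledPartitions a).card := by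
  exact_mod_cast Finset.card_pos.2 ⟨_, fst_mem_labelledPartitions a⟩

/-- A weight of maximum positive density has pairwise distinct parts. -/
theorem distinctPartSizes_of_isMax (hr : 2 ≤ r) (ha : ∀ i, 1 ≤ a i) (hF : StronglyUnbalanced a)
    {l : ℕ} {x : Fin l → ℝ} (hx : x ∈ stdSimplex ℝ (Fin l))
    (hpos : 0 < homDensity (completePartite a) ⊤ x)
    (hmax : ∀ z ∈ stdSimplex ℝ (Fin l),
      homDensity (completePartite a) ⊤ z ≤ homDensity (completePartite a) ⊤ x) :
    DistinctPartSizes x := by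
  have hN := labelledPartitions_card_pos a
  intro u v huv hu _ he
  rw [homDensity_completePartite ha hF.injective] at hpos
  obtain ⟨s, t, hs, ht, hst, hlt⟩ := exists_partiteSum_lt hr ha hF hx.1
    (pos_of_mul_pos_right hpos hN.le) huv (lt_of_le_of_ne (hx.1 u) (Ne.symm hu)) he
  have h := hmax (replaceTwo x u v s t)
    ⟨replaceTwo_nonneg hx.1 hs ht, (sum_replaceTwo x huv hst).trans hx.2⟩
  rw [homDensity_completePartite ha hF.injective, homDensity_completePartite ha hF.injective] at h
  exact absurd (le_of_mul_le_mul_left h hN) (not_le.2 hlt)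

theorem exists_cliqueFree_maximizer (hr : 2 ≤ r) (ha : ∀ i, 1 ≤ a i) (hF : StronglyUnbalanced a)
    {k : ℕ} (hk : r < k) :
    ∃ x ∈ stdSimplex ℝ (Fin (k - 1)), 0 < homDensity (completePartite a) ⊤ x ∧
      (∀ l, l < k → ∀ z ∈ stdSimplex ℝ (Fin l),
        homDensity (completePartite a) ⊤ z ≤ homDensity (completePartite a) ⊤ x) ∧
      Tendsto (fun n => maxDensityCliqueFree (completePartite a) k n) atTop
        (𝓝 (homDensity (completePartite a) ⊤ x)) := by
  have hr0 : (0 : ℝ) < r := by exact_mod_cast (by omega : 0 < r)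
  obtain ⟨x, hx, hmax⟩ := exists_maximizer (completePartite a) (show 0 < k - 1 by omega)
  refine ⟨x, hx, ?_, fun l hl z hz => hmax z hz.1 hz.2 ?_, ?_⟩
  · refine lt_of_lt_of_le ?_ (hmax (fun _ : Fin r => (r : ℝ)⁻¹) (fun _ => by positivity)
      (by simp [hr0.ne']) ((Finset.card_filter_le _ _).trans (by simp; omega)))
    rw [homDensity_completePartite ha hF.injective]
    exact mul_pos (labelledPartitions_card_pos a) (partiteSum_uniform_pos hr)
  · exact (Finset.card_filter_le _ _).trans (by simp; omega)
  · have hne : ∀ n, Nonempty {G : SimpleGraph (Fin n) // G.CliqueFree k} := fun n =>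
      ⟨⟨⊥, SimpleGraph.cliqueFree_bot (by omega)⟩⟩
    refine tendsto_iSup_inducedDensity (ι := fun n => {G : SimpleGraph (Fin n) // G.CliqueFree k})
      (fun n G => G.1) hx (fun n q => ⟨⟨_, ?_⟩, rfl⟩) ?_
    · have hc : ((⊤ : SimpleGraph (Fin (k - 1))).comap q).Colorable (k - 1) :=
        ⟨SimpleGraph.Coloring.mk q fun h => by simpa using h⟩
      exact hc.cliqueFree (by omega)
    · rintro n - ⟨G, hG⟩ y hy hy1
      obtain ⟨z, hz, hz1, hle, hcl⟩ :=
        exists_clique_support (isCompleteMultipartite_completePartite a) G hy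
      refine hle.trans ?_
      rw [homDensity_eq_top hcl]
      refine hmax z hz (hz1.trans hy1) ?_
      by_contra hcon
      -- A support with more than k - 1 vertices would be a forbidden clique.
      refine (hG.mono (show k ≤ (Finset.univ.filter fun i => z i ≠ 0).card by omega)) _ ⟨?_, rfl⟩
      simpa using hcl

theorem exists_global_maximizer (hr : 2 ≤ r) (ha : ∀ i, 1 ≤ a i) (hF : StronglyUnbalanced a) :
    ∃ m, ∃ x ∈ stdSimplex ℝ (Fin m), 0 < homDensity (completePartite a) ⊤ x ∧
      (∀ l, ∀ z ∈ stdSimplex ℝ (Fin l),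
        homDensity (completePartite a) ⊤ z ≤ homDensity (completePartite a) ⊤ x) ∧
      Tendsto (fun n => maxDensity (completePartite a) n) atTop
        (𝓝 (homDensity (completePartite a) ⊤ x)) := by
  have hr0 : (0 : ℝ) < r := by exact_mod_cast (by omega : 0 < r)
  have hN := labelledPartitions_card_pos a
  obtain ⟨L, hL⟩ := exists_bounded_support hr ha hF.injective (partiteSum_uniform_pos (a := a) hr)
  -- At least r parts are admitted so that the uniform weight competes too: it handles all weights
  -- below the threshold, for which L gives no bound.
  obtain ⟨x, hx, hmax⟩ := exists_maximizer (completePartite a) (show 0 < max L r by omega)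
  have hunif := hmax (fun _ : Fin r => (r : ℝ)⁻¹) (fun _ => by positivity)
    (by simp [hr0.ne']) ((Finset.card_filter_le _ _).trans (by simp))
  have hall : ∀ {W : Type} [Fintype W] [DecidableEq W] (y : W → ℝ), (∀ i, 0 ≤ y i) →
      ∑ i, y i = 1 → homDensity (completePartite a) ⊤ y ≤ homDensity (completePartite a) ⊤ x := by
    intro W _ _ y hy hy1
    by_cases hE : partiteSum a (fun _ : Fin r => (r : ℝ)⁻¹) ≤ partiteSum a y
    · obtain ⟨z, hz, hz1, hcard, hle⟩ := hL W y hy hy1 hE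
      refine le_trans ?_ (hmax z hz hz1 (hcard.trans (le_max_left _ _)))
      rw [homDensity_completePartite ha hF.injective, homDensity_completePartite ha hF.injective]
      exact mul_le_mul_of_nonneg_left hle hN.le
    · refine le_trans ?_ hunif
      rw [homDensity_completePartite ha hF.injective, homDensity_completePartite ha hF.injective]
      exact mul_le_mul_of_nonneg_left (not_le.1 hE).le hN.le
  refine ⟨_, x, hx, lt_of_lt_of_le ?_ hunif, fun l z hz => hall z hz.1 hz.2, ?_⟩
  · rw [homDensity_completePartite ha hF.injective]
    exact mul_pos hN (partiteSum_uniform_pos hr)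
  · refine tendsto_iSup_inducedDensity (ι := fun n => SimpleGraph (Fin n)) (fun _ G => G) hx
      (fun n q => ⟨_, rfl⟩) ?_
    intro n _ G y hy hy1
    obtain ⟨z, hz, hz1, hle, hcl⟩ :=
      exists_clique_support (isCompleteMultipartite_completePartite a) G hy
    refine hle.trans ?_
    rw [homDensity_eq_top hcl]
    exact hall z hz (hz1.trans hy1)

end StronglyUnbalanced

end Inducibility

theorem theorem1p10 (r : ℕ) (hr : 2 ≤ r) (a : Fin r → ℕ) (ha : ∀ i, 1 ≤ a i)
    (hF : Inducibility.StronglyUnbalanced a) :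
    (∀ k : ℕ, r < k →
      (∃ l : ℕ, l < k ∧ ∃ x ∈ stdSimplex ℝ (Fin l), (∀ i, 0 < x i) ∧
        Inducibility.AttainsCliqueFreeInducibility (Inducibility.completePartite a) k
          (Inducibility.completePartiteGraphon x)) ∧
      (∀ l : ℕ, l < k → ∀ x ∈ stdSimplex ℝ (Fin l),
        Inducibility.AttainsCliqueFreeInducibility (Inducibility.completePartite a) k
          (Inducibility.completePartiteGraphon x) →
        Inducibility.DistinctPartSizes x)) ∧
    (∃ l : ℕ, ∃ x ∈ stdSimplex ℝ (Fin l), (∀ i, 0 < x i) ∧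
      Inducibility.AttainsInducibility (Inducibility.completePartite a)
        (Inducibility.completePartiteGraphon x)) ∧
    (∀ l : ℕ, ∀ x ∈ stdSimplex ℝ (Fin l),
      Inducibility.AttainsInducibility (Inducibility.completePartite a)
        (Inducibility.completePartiteGraphon x) →
      Inducibility.DistinctPartSizes x) := by
  refine ⟨fun k hk => ?_, ?_⟩
  · obtain ⟨x, hx, hpos, hmax, hlim⟩ := Inducibility.exists_cliqueFree_maximizer hr ha hF hk
    refine ⟨?_, fun l hl z hz hatt => ?_⟩
    · obtain ⟨z, hz, hz0, he⟩ :=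
        Inducibility.exists_pos_stdSimplex (F := Inducibility.completePartite a) hx.1 hx.2
      refine ⟨_, ((Finset.card_filter_le _ _).trans (by simp)).trans_lt
        (show k - 1 < k by omega), z, hz, hz0, ?_⟩
      unfold Inducibility.AttainsCliqueFreeInducibility
      rwa [Inducibility.inducedDensity_completePartiteGraphon hz, he]
    · unfold Inducibility.AttainsCliqueFreeInducibility at hatt
      rw [Inducibility.inducedDensity_completePartiteGraphon hz] at hatt
      -- Uniqueness of limits turns attainment into maximality among weights with l parts.
      have he := tendsto_nhds_unique hatt hlim
      exact Inducibility.distinctPartSizes_of_isMax hr ha hF hz (he ▸ hpos)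
        fun w hw => he ▸ hmax l hl w hw
  · obtain ⟨m, x, hx, hpos, hmax, hlim⟩ := Inducibility.exists_global_maximizer hr ha hF
    refine ⟨?_, fun l z hz hatt => ?_⟩
    · obtain ⟨z, hz, hz0, he⟩ :=
        Inducibility.exists_pos_stdSimplex (F := Inducibility.completePartite a) hx.1 hx.2
      refine ⟨_, z, hz, hz0, ?_⟩
      unfold Inducibility.AttainsInducibility
      rwa [Inducibility.inducedDensity_completePartiteGraphon hz, he]
    · unfold Inducibility.AttainsInducibility at hatt
      rw [Inducibility.inducedDensity_completePartiteGraphon hz] at hatt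
      have he := tendsto_nhds_unique hatt hlim
      exact Inducibility.distinctPartSizes_of_isMax hr ha hF hz (he ▸ hpos)
        fun w hw => he ▸ hmax l w hw
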